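/- All graphs are finite. An oriented graph is a digraph without loops and without two arcs joining the same pair of vertices. A partially oriented graph (pog) $P=(V,E\cup A)$ is the edge-disjoint union of a simple graph $(V,E)$ and an oriented graph $(V,A)$ on the same vertex set $V$, so that no two vertices are joined by both an edge and an arc. To complete $P$ means to obtain an oriented graph on $V$ by replacing each edge in $E$ by an arc in one of the two possible ways (the arcs in $A$ are kept). An in-tournament is an oriented graph in which the set of in-neighbours of every vertex induces a tournament, that is, any two distinct in-neighbours of a vertex are joined by an arc. Theorem 5.4. The orientation completion problem for the class of in-tournaments is polynomial. That is, there are a (deterministic) Turing machine and a polynomial $p$ such that the machine, given any pog $P$ as input (written as its adjacency matrix, over a fixed finite alphabet), halts with the correct answer to the question "Can $P$ be completed to an in-tournament?" after at most $p(\ell)$ steps, where $\ell$ is the length of the input word (for a pog with $n$ vertices, $\ell=n(n+1)$). -/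

import Mathlib

/-- An oriented graph: a digraph without loops and without two arcs joining the same pair of
vertices. Both exclusions together say that the arc relation is asymmetric. -/
structure OrientedGraph (V : Type) extends Digraph V where
  asymm : ∀ u v, Adj u v → ¬ Adj v u

namespace OrientedGraph

variable {V : Type}

/-- The oriented graph induced by a set of vertices. -/
def induce (D : OrientedGraph V) (S : Set V) : OrientedGraph S where
  Adj u v := D.Adj u v
  asymm u v := D.asymm u v

/-- A tournament: any two distinct vertices are joined by an arc. -/
def IsTournament (D : OrientedGraph V) : Prop :=
  ∀ u v, u ≠ v → D.Adj u v ∨ D.Adj v u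

/-- The set of in-neighbours of a vertex. -/
def inNeighborSet (D : OrientedGraph V) (v : V) : Set V :=
  {u | D.Adj u v}

/-- An in-tournament: the in-neighbours of every vertex induce a tournament. -/
def IsInTournament (D : OrientedGraph V) : Prop :=
  ∀ v, (D.induce (D.inNeighborSet v)).IsTournament

end OrientedGraph

/-- A partially oriented graph (pog): the edge-disjoint union of a simple graph and an oriented
graph on the same vertex set. -/
structure PartiallyOrientedGraph (V : Type) where
  edges : SimpleGraph V
  arcs : OrientedGraph V
  disjoint : ∀ u v, edges.Adj u v → ¬ arcs.Adj u v

namespace PartiallyOrientedGraph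

variable {V : Type}

/-- The oriented graph `D` is obtained from the pog `P` by replacing each edge by an arc in one of
the two possible ways, all arcs of `P` being kept. -/
structure IsCompletion (P : PartiallyOrientedGraph V) (D : OrientedGraph V) : Prop where
  keeps_arcs : ∀ u v, P.arcs.Adj u v → D.Adj u v
  orients_edges : ∀ u v, P.edges.Adj u v → D.Adj u v ∨ D.Adj v u
  adds_nothing : ∀ u v, D.Adj u v → P.arcs.Adj u v ∨ P.edges.Adj u v

/-- The ways in which an ordered pair `(u, v)` of vertices can be related in a pog, and a marker for
the end of a row of the adjacency matrix. -/
inductive Symbol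
  | nonadjacent
  | edge
  | outArc
  | inArc
  | endRow
  deriving DecidableEq

instance : Fintype Symbol where
  elems := {.nonadjacent, .edge, .outArc, .inArc, .endRow}
  complete x := by cases x <;> decide

open Classical in
/-- The entry of the adjacency matrix at position `(u, v)`. -/
noncomputable def entry (P : PartiallyOrientedGraph V) (u v : V) : Symbol :=
  if P.arcs.Adj u v then .outArc
  else if P.arcs.Adj v u then .inArc
  else if P.edges.Adj u v then .edge
  else .nonadjacent

/-- The row of a vertex in the adjacency matrix, followed by the end marker. -/
noncomputable def row {n : ℕ} (P : PartiallyOrientedGraph (Fin n)) (u : Fin n) : List Symbol :=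
  (List.finRange n).map (P.entry u) ++ [Symbol.endRow]

/-- The instances: finite pogs, with vertices numbered `0, …, n - 1`. -/
abbrev Instance : Type := Σ n : ℕ, PartiallyOrientedGraph (Fin n)

/-- An instance is written down as its adjacency matrix, row by row. The word has length
`n * (n + 1)`. -/
noncomputable def encode (P : Instance) : List Symbol :=
  (List.finRange P.1).flatMap P.2.row

theorem length_encode (P : Instance) : (encode P).length = P.1 * (P.1 + 1) := by
  simp [encode, row, List.length_flatMap]

theorem entry_injective {P Q : PartiallyOrientedGraph V}
    (h : ∀ u v, P.entry u v = Q.entry u v) : P = Q := by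
  classical
  have ha : ∀ (R : PartiallyOrientedGraph V) u v,
      R.arcs.Adj u v ↔ R.entry u v = Symbol.outArc := by
    intro R u v
    unfold entry
    split_ifs <;> simp_all
  have he : ∀ (R : PartiallyOrientedGraph V) u v,
      R.edges.Adj u v ↔ R.entry u v = Symbol.edge := by
    intro R u v
    have h1 := R.disjoint u v
    have h2 := R.disjoint v u
    have h3 := R.edges.adj_comm u v
    unfold entry
    split_ifs <;> simp_all
  obtain ⟨G, ⟨⟨A⟩, hA⟩, hP⟩ := P
  obtain ⟨H, ⟨⟨B⟩, hB⟩, hQ⟩ := Q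
  have e1 : G = H := by
    ext u v
    rw [he ⟨G, ⟨⟨A⟩, hA⟩, hP⟩ u v, he ⟨H, ⟨⟨B⟩, hB⟩, hQ⟩ u v, h]
  have e2 : A = B := by
    funext u v
    exact propext ((ha ⟨G, ⟨⟨A⟩, hA⟩, hP⟩ u v).trans
      ((h u v) ▸ (ha ⟨H, ⟨⟨B⟩, hB⟩, hQ⟩ u v).symm))
  subst e1 e2
  rfl

/-- Different instances are written down as different words. -/
theorem encode_injective : Function.Injective encode := by
  have aux : ∀ {α : Type} (f g : α → List Symbol), (∀ a, (f a).length = (g a).length) →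
      ∀ l : List α, l.flatMap f = l.flatMap g → ∀ a ∈ l, f a = g a := by
    intro α f g hl l
    induction l with
    | nil => simp
    | cons a l ih =>
      intro h b hb
      simp only [List.flatMap_cons] at h
      obtain ⟨h1, h2⟩ := List.append_inj h (hl a)
      rcases List.mem_cons.1 hb with rfl | hb
      · exact h1
      · exact ih h2 b hb
  rintro ⟨n, P⟩ ⟨m, Q⟩ h
  have hlen := congrArg List.length h
  rw [length_encode, length_encode] at hlen
  obtain rfl : n = m := by
    simp only at hlen
    nlinarith [lt_trichotomy n m]
  have hrow := aux P.row Q.row (by simp [row]) (List.finRange n) h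
  have hPQ : P = Q := entry_injective fun u v => by
    have h1 := hrow u (List.mem_finRange u)
    unfold row at h1
    exact List.map_inj_left.1 (List.append_cancel_right h1) v (List.mem_finRange v)
  rw [hPQ]

end PartiallyOrientedGraph

/-- The decision problem "does the instance `a`, written as the word `enc a` over `Γ`, satisfy `p`?"
is polynomial: some Turing machine answers it correctly on every instance, in a number of steps
bounded by a polynomial in the length of the word. -/
def IsPolynomialProblem {α Γ : Type} (enc : α → List Γ) (p : α → Prop) : Prop :=
  ∃ answer : α → Bool, (∀ a, answer a = true ↔ p a) ∧
    Nonempty (Turing.TM2ComputableInPolyTime enc Computability.encodeBool answer)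

/-- The orientation completion problem for a class `C` of oriented graphs: can the given pog be
completed to an oriented graph in `C`? -/
def OrientationCompletionProblem (C : ∀ {V : Type}, OrientedGraph V → Prop)
    (P : PartiallyOrientedGraph.Instance) : Prop :=
  ∃ D : OrientedGraph (Fin P.1), P.2.IsCompletion D ∧ C D

/-! A completion chooses one of the orientations `(u, v)` and `(v, u)` of every joined pair, so it
is a truth assignment to orientations, with `Prod.swap` as negation. The in-tournament condition is
a set of binary clauses: if `u, v` and `v, w` are joined while `u ≠ w` are not, then `u → v` and `w
→ v` exclude each other, so `(u, v)` implies `(v, w)`. A prescribed arc `v → u` becomes the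
implication from `(u, v)` to `(v, u)`. This is an instance of 2-satisfiability. The implications are
closed under contraposition (`implies_swap`), and a completion exists iff no orientation of a joined
pair is equivalent to its opposite (`consistent_iff`): the arcs of a completion are closed under
implication, and conversely `exists_truth_assignment` provides a consistent choice by Zorn's lemma.

This criterion is tested by graph search. For each pair `(a, b)`, mark it, spread the marks along
implications, and record whether `(b, a)` has been reached. A round of spreading adds a mark unless
the marked set is already closed, and there are only `n * n` entries, so `n * n` rounds suffice
(`closed_saturate`).

To obtain a Turing machine, the search is written as a `MatrixProg`: constantly many nested loops
over row numbers, with access to single matrix entries. The matrix lies on two stacks that act as a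
tape with a head between them, and loop variables are unary counters. An access takes `O(n ^ 2)`
steps, so a well-formed program is polynomial (`exists_run_compile`). Structured stack commands are
in turn compiled to `TM2` machines with the same number of steps (`Run.reachesIn`). The search
itself is then verified on the level of `MatrixProg.eval`, where every loop is handled by a preorder
on states (`iterateUpTo_rel`, `iterateUpTo_of_rel`). -/

open Turing Function

/-! ### Structured stack programs and their compilation to Turing machines. -/

/-- Structured programs acting on a finite memory `σ` and on stacks `k : K` with entries in
`Γ k`. The command `drain k f c` empties the stack `k`, running `c` after each popped entry. -/
inductive StackCmd (K : Type) (Γ : K → Type) (σ : Type) : Type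
  | push (k : K) (f : σ → Γ k)
  | pop (k : K) (f : σ → Option (Γ k) → σ)
  | load (f : σ → σ)
  | seq (c d : StackCmd K Γ σ)
  | when (b : σ → Bool) (c : StackCmd K Γ σ)
  | drain (k : K) (f : σ → Γ k → σ) (c : StackCmd K Γ σ)

namespace StackCmd

variable {K : Type} {Γ : K → Type} {σ : Type}

section Semantics

variable [DecidableEq K]

/-- `Run c v S v' S' t`: started with memory `v` and stacks `S`, the command `c` ends with memory
`v'` and stacks `S'` after at most `t` steps. -/
inductive Run : StackCmd K Γ σ → σ → (∀ k, List (Γ k)) → σ → (∀ k, List (Γ k)) → ℕ → Prop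
  | push (k f v S) : Run (.push k f) v S v (update S k (f v :: S k)) 1
  | pop (k f v S) : Run (.pop k f) v S (f v (S k).head?) (update S k (S k).tail) 1
  | load (f v S) : Run (.load f) v S (f v) S 1
  | seq {c d v S v₁ S₁ v₂ S₂ t₁ t₂} : Run c v S v₁ S₁ t₁ → Run d v₁ S₁ v₂ S₂ t₂ →
      Run (.seq c d) v S v₂ S₂ (t₁ + t₂)
  | when_true {b c v S v' S' t} : b v = true → Run c v S v' S' t →
      Run (.when b c) v S v' S' (1 + t)
  | when_false {b c v S} : b v = false → Run (.when b c) v S v S 1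
  | drain_nil {k f c v S} : S k = [] → Run (.drain k f c) v S v S 1
  | drain_cons {k f c v S a l v₁ S₁ v₂ S₂ t₁ t₂} : S k = a :: l →
      Run c (f v a) (update S k l) v₁ S₁ t₁ → Run (.drain k f c) v₁ S₁ v₂ S₂ t₂ →
      Run (.drain k f c) v S v₂ S₂ (1 + t₁ + t₂)
  | weaken {c v S v' S' t t'} : Run c v S v' S' t → t ≤ t' → Run c v S v' S' t'

end Semantics

/-- The control states of a compiled command. -/
def Label : StackCmd K Γ σ → Type
  | push _ _ => Unit
  | pop _ _ => Unit
  | load _ => Unit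
  | seq c d => Label c ⊕ Label d
  | when _ c => Option (Label c)
  | drain _ _ c => Option (Label c)

instance labelFintype : (c : StackCmd K Γ σ) → Fintype (Label c)
  | push _ _ => inferInstanceAs (Fintype Unit)
  | pop _ _ => inferInstanceAs (Fintype Unit)
  | load _ => inferInstanceAs (Fintype Unit)
  | seq c d => @instFintypeSum _ _ (labelFintype c) (labelFintype d)
  | when _ c => @instFintypeOption _ (labelFintype c)
  | drain _ _ c => @instFintypeOption _ (labelFintype c)

/-- The control state in which a compiled command starts. -/
def entryLabel : (c : StackCmd K Γ σ) → Label c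
  | push _ _ => ()
  | pop _ _ => ()
  | load _ => ()
  | seq c _ => Sum.inl (entryLabel c)
  | when _ _ => (none : Option _)
  | drain _ _ _ => (none : Option _)

/-- The statement executed in each control state of a compiled command, where `emb` embeds the
control states into those of the whole machine and `exit` is the control state to continue with.
The additional bit of memory records whether the last popped stack was nonempty. -/
def code {Λ : Type} : (c : StackCmd K Γ σ) → (exit : Λ) → (emb : Label c → Λ) → Label c →
    TM2.Stmt Γ Λ (σ × Bool)
  | push k f, exit, _, _ => .push k (fun v => f v.1) (.goto fun _ => exit)
  | pop k f, exit, _, _ => .pop k (fun v o => (f v.1 o, false)) (.goto fun _ => exit)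
  | load f, exit, _, _ => .load (fun v => (f v.1, false)) (.goto fun _ => exit)
  | seq c d, exit, emb, l =>
    match l with
    | Sum.inl l => code c (emb (Sum.inr (entryLabel d))) (fun l => emb (Sum.inl l)) l
    | Sum.inr l => code d exit (fun l => emb (Sum.inr l)) l
  | when b c, exit, emb, l =>
    match l with
    | none => .branch (fun v => b v.1) (.goto fun _ => emb (some (entryLabel c)))
        (.goto fun _ => exit)
    | some l => code c exit (fun l => emb (some l)) l
  | drain k f c, exit, emb, l =>
    match l with
    | none => .pop k (fun v o => match o with
          | none => (v.1, false)
          | some a => (f v.1 a, true))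
        (.branch (fun v => v.2)
          (.load (fun v => (v.1, false)) (.goto fun _ => emb (some (entryLabel c))))
          (.goto fun _ => exit))
    | some l => code c (emb none) (fun l => emb (some l)) l

variable [DecidableEq K]

/-- The machine `m` gets from one configuration to another in at most `t` steps. -/
def ReachesIn {Λ τ : Type} (m : Λ → TM2.Stmt Γ Λ τ) (t : ℕ) (a b : TM2.Cfg Γ Λ τ) : Prop :=
  ∃ t' ≤ t, (flip bind (TM2.step m))^[t'] (some a) = some b

theorem ReachesIn.trans {Λ τ : Type} {m : Λ → TM2.Stmt Γ Λ τ} {t₁ t₂ : ℕ}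
    {a b c : TM2.Cfg Γ Λ τ} (h₁ : ReachesIn m t₁ a b) (h₂ : ReachesIn m t₂ b c) :
    ReachesIn m (t₁ + t₂) a c := by
  obtain ⟨s₁, hs₁, e₁⟩ := h₁
  obtain ⟨s₂, hs₂, e₂⟩ := h₂
  exact ⟨s₂ + s₁, by omega, by rw [iterate_add_apply, e₁, e₂]⟩

theorem ReachesIn.single {Λ τ : Type} {m : Λ → TM2.Stmt Γ Λ τ} {a b : TM2.Cfg Γ Λ τ}
    (h : TM2.step m a = some b) : ReachesIn m 1 a b :=
  ⟨1, le_rfl, h⟩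

/-- A compiled command does what the command does, in the same time. -/
theorem Run.reachesIn {Λ : Type} {m : Λ → TM2.Stmt Γ Λ (σ × Bool)} {c : StackCmd K Γ σ}
    {v v' : σ} {S S' : ∀ k, List (Γ k)} {t : ℕ} (h : Run c v S v' S' t) :
    ∀ (exit : Λ) (emb : Label c → Λ), (∀ l, m (emb l) = code c exit emb l) →
      ReachesIn m t ⟨some (emb (entryLabel c)), (v, false), S⟩ ⟨some exit, (v', false), S'⟩ := by
  induction h with
  | push k f v S =>
    intro exit emb hm
    exact .single (by simp [hm, code])
  | pop k f v S =>
    intro exit emb hm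
    exact .single (by simp [hm, code])
  | load f v S =>
    intro exit emb hm
    exact .single (by simp [hm, code])
  | seq _ _ ih₁ ih₂ =>
    intro exit emb hm
    exact (ih₁ _ (fun l => emb (Sum.inl l)) fun l => hm (Sum.inl l)).trans
      (ih₂ exit (fun l => emb (Sum.inr l)) fun l => hm (Sum.inr l))
  | when_true hb _ ih =>
    intro exit emb hm
    refine ReachesIn.trans (.single ?_) (ih exit (fun l => emb (some l)) fun l => hm (some l))
    rw [TM2.step, hm]
    simp [entryLabel, code, hb]
  | when_false hb =>
    intro exit emb hm
    exact .single (by rw [TM2.step, hm]; simp [entryLabel, code, hb])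
  | @drain_nil k f c v S hS =>
    intro exit emb hm
    have hu : update S k [] = S := by rw [← hS, update_eq_self]
    exact .single (by rw [TM2.step, hm]; simp [entryLabel, code, hS, hu])
  | drain_cons hS _ _ ih₁ ih₂ =>
    intro exit emb hm
    refine ReachesIn.trans (ReachesIn.trans (.single ?_)
      (ih₁ (emb none) (fun l => emb (some l)) fun l => hm (some l))) (ih₂ exit emb hm)
    rw [TM2.step, hm]
    simp [entryLabel, code, hS]
  | weaken _ ht ih =>
    intro exit emb hm
    obtain ⟨s, hs, e⟩ := ih exit emb hm
    exact ⟨s, hs.trans ht, e⟩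

/-- The machine that runs a command and halts. -/
def machine (c : StackCmd K Γ σ) [Fintype K] [Fintype σ] (k₀ k₁ : K) [Fintype (Γ k₀)] (v : σ) :
    FinTM2 where
  K := K
  k₀ := k₀
  k₁ := k₁
  Γ := Γ
  Λ := Option (Label c)
  main := some (entryLabel c)
  σ := σ × Bool
  initialState := (v, false)
  m
    | none => .halt
    | some l => code c none some l

/-- A command that replaces the encoding of every instance by the answer, in polynomial time and
restoring the memory, solves the problem. -/
theorem isPolynomialProblem (c : StackCmd K Γ σ) [Fintype K] [Fintype σ] {k₀ k₁ : K}
    [Fintype (Γ k₀)] (v : σ) {α Γ₀ : Type} (enc : α → List Γ₀) (p : α → Prop)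
    (e₀ : Γ k₀ ≃ Γ₀) (e₁ : Γ k₁ ≃ Bool) (answer : α → Bool) (hp : ∀ a, answer a = true ↔ p a)
    (q : Polynomial ℕ)
    (h : ∀ a, Run c v (update (fun _ => []) k₀ ((enc a).map e₀.symm)) v
      (update (fun _ => []) k₁ [e₁.symm (answer a)]) (q.eval (enc a).length)) :
    IsPolynomialProblem enc p := by
  refine ⟨answer, hp, ⟨⟨⟨c.machine k₀ k₁ v, e₀, e₁⟩, q + 1, fun a => ?_⟩⟩⟩
  have hr : ReachesIn (c.machine k₀ k₁ v).m (q.eval (enc a).length + 1)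
      (initList (c.machine k₀ k₁ v) ((enc a).map e₀.symm))
      (haltList (c.machine k₀ k₁ v) [e₁.symm (answer a)]) := by
    have h1 := (h a).reachesIn (m := (c.machine k₀ k₁ v).m) none some fun l => rfl
    -- `initList` and `haltList` are given by a transport along `k' = k`; this identifies them with
    -- `update`.
    have hu : ∀ (k : K) (s : List (Γ k)), update (fun _ => []) k s =
        fun k' => @dite (List (Γ k')) (k' = k) _ (fun h => by rw [h]; exact s) fun _ => [] := by
      intro k s
      funext k'
      by_cases hk : k' = k
      · subst hk; simp
      · simp [hk]
    rw [hu, hu] at h1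
    -- The label `none` still has to execute `halt`; this is the extra step in `q + 1`.
    exact h1.trans (.single rfl)
  choose t ht e using hr
  exact ⟨⟨t, e⟩, ht.trans (by simp)⟩

end StackCmd

namespace StackCmd

variable {K : Type} {Γ : K → Type} {σ : Type} [DecidableEq K]

/-- The rule for `drain`: the states `v i`, `S i` are those before the `i`-th round. -/
theorem Run.drain {k : K} {f : σ → Γ k → σ} {c : StackCmd K Γ σ} (l : List (Γ k)) (v : ℕ → σ)
    (S : ℕ → ∀ k, List (Γ k)) (T : ℕ) (hk : ∀ i ≤ l.length, S i k = l.drop i)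
    (hstep : ∀ i (h : i < l.length),
      Run c (f (v i) l[i]) (update (S i) k (l.drop (i + 1))) (v (i + 1)) (S (i + 1)) T) :
    Run (.drain k f c) (v 0) (S 0) (v l.length) (S l.length) (l.length * (T + 1) + 1) := by
  -- Induction on the number `j` of rounds that remain, since `Run.drain_cons` splits off the first
  -- round.
  have key : ∀ j ≤ l.length, Run (.drain k f c) (v (l.length - j)) (S (l.length - j))
      (v l.length) (S l.length) (j * (T + 1) + 1) := by
    intro j
    induction j with
    | zero =>
      intro _
      simpa using Run.drain_nil (by simp [hk])
    | succ j ih =>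
      intro hj
      have hi : l.length - (j + 1) < l.length := by omega
      have hcons := hk _ hi.le
      rw [List.drop_eq_getElem_cons hi] at hcons
      have h1 := hstep _ hi
      have he : l.length - (j + 1) + 1 = l.length - j := by omega
      rw [he] at h1 hcons
      refine (Run.drain_cons hcons h1 (ih (by omega))).weaken ?_
      rw [Nat.succ_mul]
      omega
  simpa using key l.length le_rfl

end StackCmd

/-! ### Unary counters and a matrix stored on two stacks. -/

/-- Names of the unary counters used to run a matrix program with variables in `ι`: the size of the
matrix, two auxiliary counters, the value of each variable and the number of rounds its loop still
has to make. -/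
inductive Counter (ι : Type)
  | size
  | aux₁
  | aux₂
  | val (i : ι)
  | rem (i : ι)
  deriving DecidableEq, Fintype

/-- Names of the stacks used to run a matrix program. The matrix is kept on the stack `right`, and
is moved to the stack `left` up to the entry that is accessed. -/
inductive StackName (ι : Type)
  | inp
  | out
  | left
  | right
  | ctr (c : Counter ι)
  deriving DecidableEq, Fintype

/-- The entries of the stacks used to run a matrix program. -/
abbrev StackName.Entry {ι : Type} (A C : Type) : StackName ι → Type
  | inp => A
  | out => Bool
  | left => C
  | right => C
  | ctr _ => Unit

/-- The contents of the stacks used to run a matrix program. -/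
structure Tapes (ι A C : Type) where
  inp : List A
  out : List Bool
  left : List C
  right : List C
  ctr : Counter ι → ℕ

namespace Tapes

variable {ι A C : Type}

/-- The contents as a function of the name of the stack. -/
def contents (t : Tapes ι A C) : (k : StackName ι) → List (k.Entry A C)
  | .inp => t.inp
  | .out => t.out
  | .left => t.left
  | .right => t.right
  | .ctr c => List.replicate (t.ctr c) ()

variable [DecidableEq ι] (t : Tapes ι A C)

theorem update_inp (l : List A) :
    update t.contents .inp l = ({t with inp := l} : Tapes ι A C).contents := by
  funext k
  cases k <;> simp [contents, update]

theorem update_out (l : List Bool) :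
    update t.contents .out l = ({t with out := l} : Tapes ι A C).contents := by
  funext k
  cases k <;> simp [contents, update]

theorem update_left (l : List C) :
    update t.contents .left l = ({t with left := l} : Tapes ι A C).contents := by
  funext k
  cases k <;> simp [contents, update]

theorem update_right (l : List C) :
    update t.contents .right l = ({t with right := l} : Tapes ι A C).contents := by
  funext k
  cases k <;> simp [contents, update]

theorem update_ctr (c : Counter ι) (m : ℕ) :
    update t.contents (.ctr c) (List.replicate m ()) =
      ({t with ctr := update t.ctr c m} : Tapes ι A C).contents := by
  funext k
  cases k with
  | ctr d =>
    by_cases h : d = c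
    · subst h; simp [contents]
    · simp [contents, h]
  | _ => simp [contents, update]

end Tapes

/-- Commands on these stacks. -/
abbrev TapeCmd (ι A C τ : Type) : Type := StackCmd (StackName ι) (StackName.Entry A C) τ

namespace TapeCmd

open StackCmd

variable {ι A C τ : Type} [DecidableEq ι]

/-- Increment a counter. -/
def incr (c : Counter ι) : TapeCmd ι A C τ := .push (.ctr c) fun _ => ()

/-- Run a command as often as a counter says, counting down to `0`. -/
def countdown (c : Counter ι) (b : TapeCmd ι A C τ) : TapeCmd ι A C τ :=
  .drain (.ctr c) (fun v _ => v) b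

theorem run_of_eq {c : TapeCmd ι A C τ} {v v' S t} {s s' : Tapes ι A C}
    (h : Run c v S v' s.contents t) (e : s = s') : Run c v S v' s'.contents t :=
  e ▸ h

theorem run_incr (c : Counter ι) (v : τ) (t : Tapes ι A C) :
    Run (incr c) v t.contents v
      ({t with ctr := update t.ctr c (t.ctr c + 1)} : Tapes ι A C).contents 1 := by
  rw [← t.update_ctr c]
  exact Run.push (.ctr c) (fun _ => ()) v t.contents

/-- The pop precedes the body, so the body of round `i` already sees the counter at `m - (i + 1)`.
-/
theorem run_countdown {c : Counter ι} {b : TapeCmd ι A C τ} (m : ℕ) (v : ℕ → τ)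
    (t : ℕ → Tapes ι A C) (T : ℕ) (hc : ∀ i ≤ m, (t i).ctr c = m - i)
    (hstep : ∀ i < m, Run b (v i)
      ({t i with ctr := update (t i).ctr c (m - (i + 1))} : Tapes ι A C).contents
      (v (i + 1)) (t (i + 1)).contents T) :
    Run (countdown c b) (v 0) (t 0).contents (v m) (t m).contents (m * (T + 1) + 1) := by
  have := Run.drain (Γ := StackName.Entry A C) (k := .ctr c) (f := fun v _ => v) (c := b)
    (List.replicate m ()) v
    (fun i => (t i).contents) T
    (by
      intro i hi
      rw [List.length_replicate] at hi
      rw [List.drop_replicate, ← hc i hi]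
      rfl)
    (by
      intro i hi
      rw [List.length_replicate] at hi
      rw [List.drop_replicate, Tapes.update_ctr]
      exact hstep i hi)
  rw [List.length_replicate] at this
  exact this

theorem run_clear {c : Counter ι} (v : τ) (t : Tapes ι A C) :
    Run (countdown c (.load id)) v t.contents v
      ({t with ctr := update t.ctr c 0} : Tapes ι A C).contents (2 * t.ctr c + 1) := by
  have := run_countdown (c := c) (b := .load id) (t.ctr c) (fun _ => v)
    (fun i => {t with ctr := update t.ctr c (t.ctr c - i)}) 1 (by simp)
    (by
      intro i _
      simp only [update_idem]
      exact Run.load id v _)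
  simp only [tsub_zero, update_eq_self, tsub_self] at this
  exact this.weaken (by omega)

/-- Move the content of a counter to another one. -/
def transfer (c d : Counter ι) : TapeCmd ι A C τ := countdown c (incr d)

theorem run_transfer {c d : Counter ι} (hcd : c ≠ d) (v : τ) (t : Tapes ι A C) :
    Run (transfer c d) v t.contents v
      ({t with ctr := update (update t.ctr c 0) d (t.ctr d + t.ctr c)} : Tapes ι A C).contents
      (2 * t.ctr c + 1) := by
  have := run_countdown (c := c) (b := incr d) (t.ctr c) (fun _ => v)
    (fun i => {t with ctr := update (update t.ctr c (t.ctr c - i)) d (t.ctr d + i)}) 1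
    (by intro i _; simp [hcd])
    (by
      intro i _
      refine run_of_eq (run_incr d v _) ?_
      simp only [Tapes.mk.injEq, true_and]
      funext z
      by_cases h1 : z = d
      · subst h1; simp [hcd.symm, add_assoc]
      · by_cases h2 : z = c <;> simp [h1, h2, hcd])
  simp only [tsub_zero, update_eq_self, tsub_self, add_zero] at this
  exact this.weaken (by omega)

end TapeCmd

namespace TapeCmd

open StackCmd

variable {ι A C σ : Type} [DecidableEq ι] [Inhabited C]

/-- The contents of the stacks when the matrix `w` is read at position `p`. -/
def reading (w : List C) (p : ℕ) (ctr : Counter ι → ℕ) : Tapes ι A C where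
  inp := []
  out := []
  left := (w.take p).reverse
  right := w.drop p
  ctr := ctr

theorem reverse_take_succ {α : Type} (w : List α) {p : ℕ} (hp : p < w.length) :
    (w.take (p + 1)).reverse = w[p] :: (w.take p).reverse := by
  rw [List.take_add_one, List.getElem?_eq_getElem hp]
  simp

/-- Move one entry of the matrix from the right to the left. -/
def advance : TapeCmd ι A C (σ × C) :=
  .seq (.pop .right fun v o => (v.1, o.getD default))
    (.seq (.push .left fun v => v.2) (.load fun v => (v.1, default)))

theorem run_advance (w : List C) {p : ℕ} (hp : p < w.length) (ctr : Counter ι → ℕ) (r : σ) :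
    Run advance (r, default) (reading (A := A) w p ctr).contents (r, default)
      (reading (A := A) w (p + 1) ctr).contents 3 := by
  have h1 := Run.pop (Γ := StackName.Entry A C) (.right : StackName ι)
    (fun (v : σ × C) o => (v.1, o.getD default)) (r, default) (reading (A := A) w p ctr).contents
  rw [Tapes.update_right] at h1
  have hd : (reading (A := A) w p ctr).contents .right = w.drop p := rfl
  rw [hd, List.drop_eq_getElem_cons hp] at h1
  have h2 := h1.seq ((Run.push (Γ := StackName.Entry A C) (.left : StackName ι)
    (fun (v : σ × C) => v.2) _ _).seq (Run.load (fun (v : σ × C) => (v.1, default)) _ _))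
  rw [Tapes.update_left] at h2
  refine run_of_eq h2 ?_
  simp only [reading, Tapes.contents, List.head?_cons, Option.getD_some, List.tail_cons,
    Tapes.mk.injEq, and_true, true_and]
  exact (reverse_take_succ w hp).symm

/-- Move the whole matrix back to the right. -/
def rewind : TapeCmd ι A C (σ × C) :=
  .drain .left (fun v a => (v.1, a))
    (.seq (.push .right fun v => v.2) (.load fun v => (v.1, default)))

theorem run_rewind (l : List C) (t : Tapes ι A C) (ht : t.left = l) (r : σ) :
    Run rewind (r, default) t.contents (r, default)
      ({t with left := [], right := l.reverse ++ t.right} : Tapes ι A C).contents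
      (3 * l.length + 1) := by
  have := Run.drain (Γ := StackName.Entry A C) (k := (.left : StackName ι))
    (f := fun (v : σ × C) a => (v.1, a))
    (c := .seq (.push .right fun v => v.2) (.load fun v => (v.1, default))) l
    (fun _ => (r, default))
    (fun i => ({t with left := l.drop i, right := (l.take i).reverse ++ t.right} :
      Tapes ι A C).contents) 2
    (by intro i _; rfl)
    (by
      intro i hi
      have h2 := (Run.push (Γ := StackName.Entry A C) (.right : StackName ι)
        (fun (v : σ × C) => v.2) (r, l[i])
        ({t with left := l.drop (i + 1), right := (l.take i).reverse ++ t.right} :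
          Tapes ι A C).contents).seq (Run.load (fun (v : σ × C) => (v.1, default)) _ _)
      rw [Tapes.update_right] at h2
      rw [Tapes.update_left]
      refine run_of_eq h2 ?_
      simp only [Tapes.contents, Tapes.mk.injEq, and_true, true_and]
      rw [reverse_take_succ l hi, List.cons_append])
  simp only [List.take_zero, List.drop_zero, List.reverse_nil, List.nil_append, List.drop_length,
    List.take_length, ← ht] at this
  simp only [← ht]
  exact this.weaken (by omega)

/-- Run a command as often as the counter `c` says, using the counter `d` to restore `c`. -/
def times {τ : Type} (c d : Counter ι) (b : TapeCmd ι A C τ) : TapeCmd ι A C τ :=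
  .seq (countdown c (.seq b (incr d))) (transfer d c)

/-- A counter can only be read by emptying it, so the rounds are tallied in `d` and the tally is
moved back to `c`. During the loop `c` and `d` have intermediate values, which is why `hb` is
required for all `ctr'` that agree with `ctr` elsewhere. Each round moves the head by `δ` entries.
-/
theorem run_times {c d : Counter ι} (hcd : c ≠ d) {b : TapeCmd ι A C (σ × C)} (w : List C) (r : σ)
    (ctr : Counter ι → ℕ) (hd : ctr d = 0) (δ T p : ℕ) (hp : p + ctr c * δ ≤ w.length)
    (hb : ∀ ctr' : Counter ι → ℕ, (∀ z, z ≠ c → z ≠ d → ctr' z = ctr z) → ∀ p, p + δ ≤ w.length →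
      Run b (r, default) (reading (A := A) w p ctr').contents (r, default)
        (reading (A := A) w (p + δ) ctr').contents T) :
    Run (times c d b) (r, default) (reading (A := A) w p ctr).contents (r, default)
      (reading (A := A) w (p + ctr c * δ) ctr).contents (ctr c * (T + 4) + 2) := by
  have h1 := run_countdown (c := c) (b := .seq b (incr d)) (ctr c) (fun _ => (r, default))
    (fun i => reading (A := A) w (p + i * δ) (update (update ctr c (ctr c - i)) d i)) (T + 1)
    (by intro i _; simp [reading, hcd])
    (by
      intro i hi
      have hle : p + i * δ + δ ≤ w.length := by nlinarith
      have h0 := (hb (update (update ctr c (ctr c - (i + 1))) d i) (by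
        intro z h1 h2; simp [h1, h2]) _ hle).seq (run_incr d _ _)
      have he : update (update (update ctr c (ctr c - i)) d i) c (ctr c - (i + 1)) =
          update (update ctr c (ctr c - (i + 1))) d i := by
        rw [update_comm hcd, update_idem, update_comm hcd.symm]
      simp only [reading] at h0 ⊢
      rw [he]
      refine run_of_eq h0 ?_
      simp [add_mul, add_assoc])
  have h2 := h1.seq (run_transfer hcd.symm _ _)
  simp only [zero_mul, add_zero, tsub_zero, update_eq_self, tsub_self] at h2
  have hs : update ctr d 0 = ctr := by rw [← hd, update_eq_self]
  rw [hs] at h2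
  refine (run_of_eq h2 ?_).weaken ?_
  · simp only [reading, Tapes.mk.injEq, true_and]
    funext z
    by_cases h1 : z = d
    · subst h1; simp [hcd.symm, hd]
    · by_cases h3 : z = c
      · subst h3; simp [hcd]
      · simp [h1, h3]
  · simp [reading]
    ring_nf
    omega

end TapeCmd

/-! ### Matrix programs with nested loops and their running time. -/

/-- Programs that run through the entries of a matrix with nested loops over the row numbers.
`access x y f` applies `f` to the memory and the entry in row `x` and column `y`; `loop x p` runs
`p` for `x = 0, …, n - 1`. -/
inductive MatrixProg (ι C σ : Type) : Type
  | access (x y : ι) (f : σ → C → σ × C)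
  | seq (p q : MatrixProg ι C σ)
  | loop (x : ι) (p : MatrixProg ι C σ)

/-- Apply `f 0`, …, `f (n - 1)` in this order. -/
def iterateUpTo {S : Type} (f : ℕ → S → S) (s : S) : ℕ → S
  | 0 => s
  | n + 1 => f n (iterateUpTo f s n)

namespace MatrixProg

variable {ι A C σ : Type} [DecidableEq ι]

/-- The effect of a program on the memory and on the matrix, which has `n` rows. -/
def eval (n : ℕ) : MatrixProg ι C σ → (ι → ℕ) → σ × (ℕ × ℕ → C) → σ × (ℕ × ℕ → C)
  | access x y f, e, s =>
    ((f s.1 (s.2 (e x, e y))).1, update s.2 (e x, e y) (f s.1 (s.2 (e x, e y))).2)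
  | seq p q, e, s => eval n q e (eval n p e s)
  | loop x p, e, s => iterateUpTo (fun i s => eval n p (update e x i) s) s n

/-- Loops are over variables not in use, and all accesses are in the range of the loops; the set
contains the variables in use. -/
def WellFormed : MatrixProg ι C σ → Finset ι → Prop
  | access x y _, V => x ∈ V ∧ y ∈ V
  | seq p q, V => WellFormed p V ∧ WellFormed q V
  | loop x p, V => x ∉ V ∧ WellFormed p (insert x V)

/-- The entries of a matrix with `n` rows and `n + 1` columns, row by row. -/
def flatten (n : ℕ) (M : ℕ × ℕ → C) : List C :=
  (List.range (n * (n + 1))).map fun p => M (p / (n + 1), p % (n + 1))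

/-- The values of the counters when the variables have values `e` and their loops still have to make
`ρ` rounds. -/
def counters (n : ℕ) (e ρ : ι → ℕ) : Counter ι → ℕ
  | .size => n
  | .aux₁ => 0
  | .aux₂ => 0
  | .val i => e i
  | .rem i => ρ i

theorem update_val (n : ℕ) (e ρ : ι → ℕ) (x : ι) (m : ℕ) :
    update (counters n e ρ) (.val x) m = counters n (update e x m) ρ := by
  funext z
  cases z with
  | val i => by_cases h : i = x <;> simp [counters, update, h]
  | _ => simp [counters]

theorem update_rem (n : ℕ) (e ρ : ι → ℕ) (x : ι) (m : ℕ) :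
    update (counters n e ρ) (.rem x) m = counters n e (update ρ x m) := by
  funext z
  cases z with
  | rem i => by_cases h : i = x <;> simp [counters, update, h]
  | _ => simp [counters]

theorem length_flatten (n : ℕ) (M : ℕ × ℕ → C) : (flatten n M).length = n * (n + 1) := by
  simp [flatten]

theorem index_lt {n a b : ℕ} (ha : a < n) (hb : b < n) : a * (n + 1) + b < n * (n + 1) := by
  nlinarith

/-- Entry `(a, b)` stands at index `a * (n + 1) + b`, and this index determines `(a, b)` by division
with remainder because `b < n + 1`. The split form matches the two stacks when the head is at this
entry. -/
theorem flatten_eq_append {n a b : ℕ} (ha : a < n) (hb : b < n) (M : ℕ × ℕ → C) (c : C) :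
    flatten n (update M (a, b) c) = (flatten n M).take (a * (n + 1) + b) ++
      c :: (flatten n M).drop (a * (n + 1) + b + 1) := by
  have hlt := index_lt ha hb
  have hset : (flatten n M).take (a * (n + 1) + b) ++
      c :: (flatten n M).drop (a * (n + 1) + b + 1) =
      (flatten n M).set (a * (n + 1) + b) c := by
    rw [List.set_eq_take_append_cons_drop, if_pos (by rwa [length_flatten])]
  rw [hset]
  refine List.ext_getElem (by simp [length_flatten]) fun p h1 h2 => ?_
  rw [List.getElem_set]
  simp only [flatten, List.getElem_map, List.getElem_range]
  have hiff : (p / (n + 1), p % (n + 1)) = (a, b) ↔ a * (n + 1) + b = p := by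
    rw [Prod.mk.injEq]
    constructor
    · rintro ⟨rfl, rfl⟩
      rw [mul_comm]
      exact Nat.div_add_mod p (n + 1)
    · rintro rfl
      constructor
      · rw [mul_comm, Nat.mul_add_div (by omega), Nat.div_eq_of_lt (by omega), add_zero]
      · rw [mul_comm, Nat.mul_add_mod, Nat.mod_eq_of_lt (by omega)]
  by_cases h : a * (n + 1) + b = p
  · rw [if_pos h, hiff.2 h, update_self]
  · rw [if_neg h, update_of_ne (mt hiff.1 h)]

theorem drop_flatten {n a b : ℕ} (ha : a < n) (hb : b < n) (M : ℕ × ℕ → C) :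
    (flatten n M).drop (a * (n + 1) + b) =
      M (a, b) :: (flatten n M).drop (a * (n + 1) + b + 1) := by
  have h := flatten_eq_append ha hb M (M (a, b))
  rw [update_eq_self] at h
  have hlen : ((flatten n M).take (a * (n + 1) + b)).length = a * (n + 1) + b := by
    rw [List.length_take, length_flatten, min_eq_left (index_lt ha hb).le]
  conv_lhs => rw [h, List.drop_left' hlen]

open StackCmd TapeCmd

/-- Copy the size of the matrix to the counter `c`. -/
def copySize {τ : Type} (c : Counter ι) : TapeCmd ι A C τ :=
  .seq (countdown .size (.seq (incr .aux₁) (incr c))) (transfer .aux₁ .size)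

theorem run_copySize {τ : Type} (n : ℕ) (x : ι) (w : List C) (e ρ : ι → ℕ) (hρ : ρ x = 0) (v : τ) :
    Run (copySize (.rem x)) v (reading (A := A) w 0 (counters n e ρ)).contents v
      (reading (A := A) w 0 (counters n e (update ρ x n))).contents (5 * n + 2) := by
  let ctr (i : ℕ) : Counter ι → ℕ
    | .size => n - i
    | .aux₁ => i
    | .aux₂ => 0
    | .val z => e z
    | .rem z => update ρ x i z
  have h1 := run_countdown (c := .size) (b := .seq (incr .aux₁) (incr (.rem x))) n (fun _ => v)
    (fun i => reading (A := A) w 0 (ctr i)) 2 (by intro i _; rfl)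
    (by
      intro i hi
      refine run_of_eq ((run_incr _ v _).seq (run_incr _ v _)) ?_
      simp only [reading, Tapes.mk.injEq, true_and]
      funext z
      cases z with
      | rem z => by_cases h : z = x <;> simp [ctr, update, h]
      | _ => simp [ctr])
  have h2 := h1.seq (run_transfer (c := .aux₁) (d := .size) (by simp) _ _)
  have h0 : ctr 0 = counters n e ρ := by
    funext z
    cases z with
    | rem z => by_cases h : z = x <;> simp [ctr, counters, update, h, hρ]
    | _ => simp [ctr, counters]
  rw [h0] at h2
  refine (run_of_eq h2 ?_).weaken ?_
  · simp only [reading, Tapes.mk.injEq, true_and]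
    funext z
    cases z <;> simp [ctr, counters]
  · simp only [reading, ctr]
    omega

variable [Inhabited C]

/-- The implementation of a program by stacks. -/
def compile : MatrixProg ι C σ → TapeCmd ι A C (σ × C)
  | access x y f =>
    .seq (times (.val x) .aux₁ (.seq (times .size .aux₂ advance) advance))
      (.seq (times (.val y) .aux₁ advance)
        (.seq (.pop .right fun v o => f v.1 (o.getD default))
          (.seq (.push .right fun v => v.2) (.seq (.load fun v => (v.1, default)) rewind))))
  | seq p q => .seq (compile p) (compile q)
  | loop x p =>
    .seq (copySize (.rem x))
      (.seq (countdown (.rem x) (.seq (compile p) (incr (.val x))))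
        (countdown (.val x) (.load id)))

/-- Skipping `e x` whole rows and then `e y` entries brings the entry to the top of `right`.
Skipping fewer than `n` rows at linear cost each, and rewinding, give the quadratic bound. -/
theorem run_access {n : ℕ} (x y : ι) (f : σ → C → σ × C) (e ρ : ι → ℕ) (hx : e x < n)
    (hy : e y < n) (s : σ × (ℕ × ℕ → C)) :
    Run (compile (A := A) (access x y f)) (s.1, default)
      (reading (A := A) (flatten n s.2) 0 (counters n e ρ)).contents
      ((eval n (access x y f) e s).1, default)
      (reading (A := A) (flatten n (eval n (access x y f) e s).2) 0 (counters n e ρ)).contents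
      (20 * (n + 1) ^ 2) := by
  obtain ⟨r, M⟩ := s
  have hidx := index_lt hx hy
  have hlen := length_flatten n M
  set w := flatten n M with hw
  -- A row has `n + 1` entries, one more than `size` says; the separate `advance` passes the end
  -- marker.
  have hrow : ∀ ctr' : Counter ι → ℕ,
      (∀ z, z ≠ .val x → z ≠ .aux₁ → ctr' z = counters n e ρ z) → ∀ p, p + (n + 1) ≤ w.length →
      Run (.seq (times .size .aux₂ advance) advance) (r, default)
        (reading (A := A) w p ctr').contents (r, default)
        (reading (A := A) w (p + (n + 1)) ctr').contents (n * (3 + 4) + 2 + 3) := by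
    intro ctr' hc p hp
    have hs : ctr' .size = n := hc _ (by simp) (by simp)
    have h1 := run_times (A := A) (c := .size) (d := .aux₂) (by simp) w r ctr'
      (hc _ (by simp) (by simp)) 1 3 p (by omega) (b := advance)
      (fun ctr'' _ p hp => run_advance w (by omega) ctr'' r)
    have h2 := h1.seq (run_advance w (by omega) ctr' r)
    rw [hs, mul_one] at h2
    exact h2
  have h1 := run_times (A := A) (c := .val x) (d := .aux₁) (by simp) w r (counters n e ρ) rfl
    (n + 1) _ 0 (by simp only [counters]; omega) hrow
  have h2 := run_times (A := A) (c := .val y) (d := .aux₁) (by simp) w r (counters n e ρ) rfl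
    1 3 (0 + counters n e ρ (.val x) * (n + 1)) (by simp only [counters]; omega) (b := advance)
    (fun ctr'' _ p hp => run_advance w (by omega) ctr'' r)
  simp only [counters, zero_add, mul_one] at h1 h2
  have h3 := Run.pop (Γ := StackName.Entry A C) (.right : StackName ι)
    (fun (v : σ × C) o => f v.1 (o.getD default)) (r, default)
    (reading (A := A) w (e x * (n + 1) + e y) (counters n e ρ)).contents
  have hr : (reading (A := A) w (e x * (n + 1) + e y) (counters n e ρ)).contents .right =
      M (e x, e y) :: w.drop (e x * (n + 1) + e y + 1) := drop_flatten hx hy M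
  rw [hr, Tapes.update_right] at h3
  have h4 := Run.push (Γ := StackName.Entry A C) (.right : StackName ι)
    (fun v : σ × C => v.2) (f r (M (e x, e y)))
    (({reading (A := A) w (e x * (n + 1) + e y) (counters n e ρ) with
      right := w.drop (e x * (n + 1) + e y + 1)} : Tapes ι A C).contents)
  rw [Tapes.update_right] at h4
  have h5 := run_rewind (w.take (e x * (n + 1) + e y)).reverse
    ({reading (A := A) w (e x * (n + 1) + e y) (counters n e ρ) with
      right := (f r (M (e x, e y))).2 :: w.drop (e x * (n + 1) + e y + 1)}) rfl
      (f r (M (e x, e y))).1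
  have h6 := h1.seq (h2.seq (h3.seq (h4.seq ((Run.load (fun v : σ × C => (v.1, default)) _ _).seq h5))))
  refine (run_of_eq h6 ?_).weaken ?_
  · simp only [reading, eval, flatten_eq_append hx hy, ← hw]
    simp
  · simp only [List.length_reverse, List.length_take, hlen, min_eq_left hidx.le]
    have := Nat.mul_le_mul_right (n * (3 + 4) + 2 + 3 + 4) hx.le
    nlinarith

/-- A well-formed program runs in polynomial time. -/
theorem exists_run_compile (p : MatrixProg ι C σ) (V : Finset ι) (hp : p.WellFormed V) :
    ∃ q : Polynomial ℕ, ∀ (n : ℕ) (e ρ : ι → ℕ), (∀ x ∈ V, e x < n) →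
      (∀ x ∉ V, e x = 0 ∧ ρ x = 0) → ∀ s : σ × (ℕ × ℕ → C),
      Run (compile (A := A) p) (s.1, default)
        (reading (A := A) (flatten n s.2) 0 (counters n e ρ)).contents
        ((eval n p e s).1, default)
        (reading (A := A) (flatten n (eval n p e s).2) 0 (counters n e ρ)).contents
        (q.eval n) := by
  induction p generalizing V with
  | access x y f =>
    refine ⟨20 * (Polynomial.X + 1) ^ 2, fun n e ρ he _ s => ?_⟩
    simpa using run_access x y f e ρ (he x hp.1) (he y hp.2) s
  | seq p₁ p₂ ih₁ ih₂ =>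
    obtain ⟨q₁, h₁⟩ := ih₁ V hp.1
    obtain ⟨q₂, h₂⟩ := ih₂ V hp.2
    refine ⟨q₁ + q₂, fun n e ρ he hρ s => ?_⟩
    rw [Polynomial.eval_add]
    exact (h₁ n e ρ he hρ s).seq (h₂ n e ρ he hρ _)
  | loop x p ih =>
    obtain ⟨q, h⟩ := ih (insert x V) hp.2
    -- Copying the size takes `5 * n + 2` steps, the loop `n * (q + 2) + 1` and resetting the
    -- variable `2 * n + 1`.
    refine ⟨Polynomial.X * (q + 9) + 4, fun n e ρ he hρ s => ?_⟩
    -- As `x` is not in use, both of its counters are `0` before the loop. They return to `0`, so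
    -- the loop leaves all counters unchanged and can itself be nested.
    obtain ⟨hex, hρx⟩ := hρ x hp.1
    let st (i : ℕ) : σ × (ℕ × ℕ → C) :=
      iterateUpTo (fun i s => eval n p (update e x i) s) s i
    have h1 := run_copySize (A := A) n x (flatten n s.2) e ρ hρx ((s.1, default) : σ × C)
    have h2 := run_countdown (c := .rem x) (b := .seq (compile p) (incr (.val x))) n
      (fun i => ((st i).1, default))
      (fun i => reading (A := A) (flatten n (st i).2) 0
        (counters n (update e x i) (update ρ x (n - i)))) (q.eval n + 1)
      (by intro i _; simp [reading, counters])
      (by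
        intro i hi
        have h3 := h n (update e x i) (update ρ x (n - (i + 1)))
          (by
            intro z hz
            by_cases hzx : z = x
            · subst hzx; simpa using hi
            · simpa [hzx] using he z ((Finset.mem_insert.1 hz).resolve_left hzx))
          (by
            intro z hz
            rw [Finset.mem_insert, not_or] at hz
            simpa [hz.1] using hρ z hz.2)
          (st i)
        have h4 := h3.seq (run_incr (.val x) _ _)
        simp only [reading, update_val, update_rem, update_idem] at h4 ⊢
        simp only [counters, update_self] at h4
        exact h4)
    have hu : update e x 0 = e := by rw [← hex, update_eq_self]
    have hu' : update ρ x 0 = ρ := by rw [← hρx, update_eq_self]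
    simp only [hu, Nat.sub_zero] at h2
    have h5 := h1.seq (h2.seq (run_clear (c := .val x) _ _))
    refine (run_of_eq h5 ?_).weaken ?_
    · simp only [reading, update_val, update_idem]
      simp [hu, hu', eval, st]
    · simp [reading, counters]
      ring_nf
      omega

end MatrixProg

/-! ### Reading the input, answering, and cleaning up. -/

namespace MatrixProg

open StackCmd TapeCmd

variable {ι A C σ : Type} [DecidableEq ι]

theorem run_clear_right {τ : Type} (v : τ) (t : Tapes ι A C) (l : List C) (ht : t.right = l) :
    Run (.drain .right (fun v _ => v) (.load id) : TapeCmd ι A C τ) v t.contents v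
      ({t with right := []} : Tapes ι A C).contents (2 * l.length + 1) := by
  have := Run.drain (Γ := StackName.Entry A C) (k := (.right : StackName ι))
    (f := fun (v : τ) _ => v) (c := .load id) l (fun _ => v)
    (fun i => ({t with right := l.drop i} : Tapes ι A C).contents) 1
    (by intro i _; rfl)
    (by
      intro i hi
      rw [Tapes.update_right]
      exact Run.load id v _)
  simp only [List.drop_zero, List.drop_length, ← ht] at this
  rw [← ht]
  exact this.weaken (by omega)

variable [Inhabited C]

/-- Read the input, turning its symbols into matrix entries and counting the row ends. -/
def loadMatrix (cell : A → C) (isEnd : C → Bool) : TapeCmd ι A C (σ × C) :=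
  .seq
    (.drain .inp (fun v a => (v.1, cell a))
      (.seq (.push .left fun v => v.2)
        (.seq (.when (fun v => isEnd v.2) (incr .size)) (.load fun v => (v.1, default)))))
    rewind

/-- The dimension is not part of the input word; it is found by counting end markers. Each symbol
costs at most five steps for reading and three for rewinding. -/
theorem run_loadMatrix (cell : A → C) (isEnd : C → Bool) (l : List A) (r : σ) :
    Run (loadMatrix (ι := ι) cell isEnd) (r, default)
      ({inp := l, out := [], left := [], right := [], ctr := fun _ => 0} : Tapes ι A C).contents
      (r, default)
      (reading (A := A) (l.map cell) 0
        (counters ((l.map cell).countP isEnd) (fun _ => 0) fun _ => 0)).contents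
      (8 * l.length + 2) := by
  have h1 := Run.drain (Γ := StackName.Entry A C) (k := (.inp : StackName ι))
    (f := fun (v : σ × C) a => (v.1, cell a))
    (c := .seq (.push .left fun v => v.2)
        (.seq (.when (fun v => isEnd v.2) (incr .size)) (.load fun v => (v.1, default)))) l
    (fun _ => (r, default))
    (fun i => Tapes.contents
      {inp := l.drop i, out := [], left := ((l.map cell).take i).reverse, right := [],
       ctr := counters (((l.map cell).take i).countP isEnd) (fun _ => 0) fun _ => 0}) 4
    (by intro i _; rfl)
    (by
      intro i hi
      -- The invariant after `i` symbols: `left` holds them in reverse and `size` counts the end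
      -- markers among them.
      have hi' : i < (l.map cell).length := by simpa using hi
      have h2 := Run.push (Γ := StackName.Entry A C) (.left : StackName ι)
        (fun (v : σ × C) => v.2) (r, cell l[i])
        ({inp := l.drop (i + 1), out := [], left := ((l.map cell).take i).reverse, right := [],
          ctr := counters (((l.map cell).take i).countP isEnd) (fun _ => 0) fun _ => 0} :
          Tapes ι A C).contents
      rw [Tapes.update_left] at h2
      rw [Tapes.update_inp]
      have h3 : ∀ t : Tapes ι A C, Run (.when (fun v : σ × C => isEnd v.2) (incr .size))
          (r, cell l[i]) t.contents (r, cell l[i])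
          (Tapes.contents {t with
            ctr := update t.ctr .size (t.ctr .size + if isEnd (cell l[i]) then 1 else 0)}) 2 := by
        intro t
        cases hc : isEnd (cell l[i]) with
        | true => exact Run.when_true (b := fun v : σ × C => isEnd v.2) hc (run_incr .size _ t)
        | false =>
          have h := (Run.when_false (b := fun v : σ × C => isEnd v.2) (c := incr (A := A) .size)
            (v := (r, cell l[i])) (S := t.contents) hc).weaken one_le_two
          refine run_of_eq h ?_
          simp
      have h4 := h2.seq ((h3 _).seq (Run.load (fun v : σ × C => (v.1, default)) _ _))
      refine run_of_eq h4 ?_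
      simp only [reverse_take_succ _ hi', Tapes.mk.injEq, true_and]
      refine ⟨by simp [Tapes.contents], ?_⟩
      rw [List.take_add_one, List.countP_append, List.getElem?_eq_getElem hi']
      funext z
      cases z <;> simp [counters])
  have h2 := h1.seq (run_rewind ((l.map cell).take l.length).reverse _ rfl r)
  have h0 : (counters 0 (fun _ => 0) fun _ => 0 : Counter ι → ℕ) = fun _ => 0 := by
    funext z
    cases z <;> rfl
  simp only [List.drop_zero, List.take_zero, List.reverse_nil, List.countP_nil, h0] at h2
  refine (run_of_eq h2 ?_).weaken ?_
  · rw [List.take_of_length_le (by simp)]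
    simp [reading]
  · simp
    omega

/-- The implementation of a program that starts with memory `r₀` and answers by `answer`. -/
def decider (p : MatrixProg ι C σ) (cell : A → C) (isEnd : C → Bool) (r₀ : σ)
    (answer : σ → Bool) : TapeCmd ι A C (σ × C) :=
  .seq (loadMatrix cell isEnd)
    (.seq (compile p)
      (.seq (.push .out fun v => answer v.1)
        (.seq (.drain .right (fun v _ => v) (.load id))
          (.seq (countdown .size (.load id)) (.load fun _ => (r₀, default))))))

theorem _root_.Polynomial.eval_mono_nat (q : Polynomial ℕ) {m n : ℕ} (h : m ≤ n) :
    q.eval m ≤ q.eval n := by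
  rw [Polynomial.eval_eq_sum_range, Polynomial.eval_eq_sum_range]
  gcongr

/-- A problem is polynomial if its instances are encoded as square matrices, with marked row ends,
and some program solves it. -/
theorem isPolynomialProblem [Fintype ι] [Fintype A] [Fintype C] [Fintype σ]
    (p : MatrixProg ι C σ) (hp : p.WellFormed ∅) (cell : A → C) (isEnd : C → Bool) (r₀ : σ)
    (answer : σ → Bool) {α : Type} (enc : α → List A) (P : α → Prop) (size : α → ℕ)
    (M : α → ℕ × ℕ → C) (hM : ∀ a, (enc a).map cell = flatten (size a) (M a))
    (hsize : ∀ a, ((enc a).map cell).countP isEnd = size a)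
    (h : ∀ a, answer (eval (size a) p (fun _ => 0) (r₀, M a)).1 = true ↔ P a) :
    IsPolynomialProblem enc P := by
  obtain ⟨q, hq⟩ := exists_run_compile (A := A) p ∅ hp
  let : Fintype (StackName.Entry A C (.inp : StackName ι)) := ‹Fintype A›
  -- The summand `12 * X + 12` covers reading the word and emptying the matrix stack and the counter
  -- `size`; all of these are linear in the input length.
  refine (decider p cell isEnd r₀ answer).isPolynomialProblem (k₀ := .inp) (k₁ := .out)
    (r₀, default) enc P (Equiv.refl A) (Equiv.refl Bool) _ h (q + 12 * Polynomial.X + 12)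
    fun a => ?_
  have hlen : (enc a).length = size a * (size a + 1) := by
    rw [← length_flatten (size a) (M a), ← hM a, List.length_map]
  have hle : size a ≤ (enc a).length := by rw [hlen]; nlinarith
  have h1 := run_loadMatrix (ι := ι) cell isEnd (enc a) r₀
  rw [hsize a, hM a] at h1
  have h2 := hq (size a) (fun _ => 0) (fun _ => 0) (by simp) (by simp) (r₀, M a)
  set s := eval (size a) p (fun _ => 0) (r₀, M a) with hs
  have h3 := Run.push (Γ := StackName.Entry A C) (.out : StackName ι)
    (fun v : σ × C => answer v.1) (s.1, default)
    (reading (A := A) (flatten (size a) s.2) 0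
      (counters (size a) (fun _ => 0) fun _ => 0)).contents
  rw [Tapes.update_out] at h3
  have h4 := run_clear_right (ι := ι) (A := A) ((s.1, default) : σ × C)
    ({reading (A := A) (flatten (size a) s.2) 0 (counters (size a) (fun _ => 0) fun _ => 0) with
      out := [answer s.1]} : Tapes ι A C) (flatten (size a) s.2) rfl
  have h5 := h1.seq (h2.seq (h3.seq (h4.seq ((run_clear (c := .size) _ _).seq
    (Run.load (fun _ : σ × C => (r₀, default)) _ _)))))
  have hin : (update (fun _ => []) .inp ((enc a).map (Equiv.refl A).symm) :
      (k : StackName ι) → List (k.Entry A C)) =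
      ({inp := enc a, out := [], left := [], right := [], ctr := fun _ => 0} :
        Tapes ι A C).contents := by
    funext k
    cases k <;> simp [Tapes.contents]
  have hout : (update (fun _ => []) .out [(Equiv.refl Bool).symm (answer s.1)] :
      (k : StackName ι) → List (k.Entry A C)) =
      ({inp := [], out := [answer s.1], left := [], right := [], ctr := fun _ => 0} :
        Tapes ι A C).contents := by
    funext k
    cases k <;> simp [Tapes.contents]
  rw [hin, hout]
  refine (run_of_eq h5 ?_).weaken ?_
  · simp only [reading, Tapes.mk.injEq, true_and, List.take_zero, List.reverse_nil]
    funext z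
    cases z <;> simp [counters]
  · have := q.eval_mono_nat hle
    simp only [length_flatten, ← hlen, reading, counters, Polynomial.eval_add,
      Polynomial.eval_mul, Polynomial.eval_X, Polynomial.eval_ofNat]
    omega

end MatrixProg

/-! ### The satisfiability criterion for implications closed under contraposition. -/

/-- The theorem behind 2-satisfiability: an implication relation that is closed under contraposition
and in which no literal of `L` is equivalent to its negation has a consistent truth assignment. -/
theorem exists_truth_assignment {α : Type} {neg : α → α} (hneg : Function.Involutive neg)
    {R : α → α → Prop} (hR : ∀ x y, R x y → R (neg y) (neg x)) {L : Set α}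
    (hL : ∀ x ∈ L, ∀ y, R x y → y ∈ L) (hLneg : ∀ x ∈ L, neg x ∈ L)
    (hno : ∀ x ∈ L, ¬ (Relation.ReflTransGen R x (neg x) ∧ Relation.ReflTransGen R (neg x) x)) :
    ∃ S : Set α, (∀ x ∈ S, ∀ y, R x y → y ∈ S) ∧ ∀ x ∈ L, x ∈ S ↔ neg x ∉ S := by
  have hcontra : ∀ x y, Relation.ReflTransGen R x y → Relation.ReflTransGen R (neg y) (neg x) := by
    intro x y h
    induction h with
    | refl => exact .refl
    | tail _ h ih => exact .head (hR _ _ h) ih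
  have hclosed : ∀ S : Set α, (∀ x ∈ S, ∀ y, R x y → y ∈ S) → ∀ x ∈ S, ∀ y,
      Relation.ReflTransGen R x y → y ∈ S := by
    intro S hS x hx y h
    induction h with
    | refl => exact hx
    | tail _ h ih => exact hS _ ih _ h
  -- `m` is a maximal set of literals that is closed under implication and contains no literal
  -- together with its negation.
  obtain ⟨m, hm⟩ := zorn_subset
    {S : Set α | S ⊆ L ∧ (∀ x ∈ S, ∀ y, R x y → y ∈ S) ∧ ∀ x ∈ S, neg x ∉ S} (by
      intro c hc hchain
      refine ⟨⋃₀ c, ⟨Set.sUnion_subset fun s hs => (hc hs).1, ?_, ?_⟩,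
        fun s hs => Set.subset_sUnion_of_mem hs⟩
      · rintro x ⟨s, hs, hx⟩ y h
        exact ⟨s, hs, (hc hs).2.1 x hx y h⟩
      · rintro x ⟨s, hs, hx⟩ ⟨t, ht, hx'⟩
        rcases hchain.total hs ht with h | h
        · exact (hc ht).2.2 x (h hx) hx'
        · exact (hc hs).2.2 x hx (h hx'))
  obtain ⟨⟨hmL, hmR, hmneg⟩, hmax⟩ := hm
  -- Adding to `m` all consequences of `x` creates no contradiction here, so maximality gives `x ∈
  -- m`.
  have hext : ∀ x ∈ L, neg x ∉ m → ¬ Relation.ReflTransGen R x (neg x) → x ∈ m := by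
    intro x hx hxm hr
    refine hmax (y := m ∪ {y | Relation.ReflTransGen R x y}) ⟨?_, ?_, ?_⟩
      Set.subset_union_left (Or.inr .refl)
    · exact Set.union_subset hmL fun y hy => hclosed L hL x hx y hy
    · rintro y (hy | hy) z h
      · exact Or.inl (hmR y hy z h)
      · exact Or.inr (hy.tail h)
    -- A consequence of `x` that contradicts some `y ∈ m` would, by contraposition, yield `neg x ∈
    -- m`.
    · have hback : ∀ y, y ∈ m → ¬ Relation.ReflTransGen R x (neg y) := by
        intro y hy h
        have := hcontra _ _ h
        rw [hneg] at this
        exact hxm (hclosed m hmR y hy _ this)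
      rintro y (hy | hy) (hy' | hy')
      · exact hmneg y hy hy'
      · exact hback y hy hy'
      · exact hback _ hy' (by rwa [hneg])
      -- If `x` implies both `y` and `neg y`, the contrapositive of the latter leads from `y` to
      -- `neg x`, so `x` implies `neg x`.
      · have := hcontra _ _ hy'
        rw [hneg] at this
        exact hr (hy.trans this)
  refine ⟨m, hmR, fun x hx => ⟨hmneg x, fun h => ?_⟩⟩
  -- If `x` implies `neg x`, then by `hno` the converse fails, so `hext` applies to `neg x` and
  -- contradicts `neg x ∉ m`.
  by_cases hr : Relation.ReflTransGen R x (neg x)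
  · refine absurd (hext (neg x) (hLneg x hx) (fun hx' => ?_) fun h' => ?_) h
    · rw [hneg] at hx'
      exact hmneg x hx' (hclosed m hmR x hx' _ hr)
    · rw [hneg] at h'
      exact hno x hx ⟨hr, h'⟩
  · exact hext x hx h hr

/-! ### Completions to in-tournaments as truth assignments. -/

namespace PartiallyOrientedGraph

/-- Two vertices with this matrix entry are joined by an edge or an arc. -/
def Symbol.isJoined : Symbol → Bool
  | edge => true
  | outArc => true
  | inArc => true
  | _ => false

/-- The implications between the orientations `u → v` of pairs of vertices, written as `(u, v)`, in
completions to an in-tournament of the pog with adjacency matrix `s`. -/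
inductive Implies (s : ℕ × ℕ → Symbol) : ℕ × ℕ → ℕ × ℕ → Prop
  | path {u v w : ℕ} : (s (u, v)).isJoined → (s (v, w)).isJoined → u ≠ w →
      s (u, w) = .nonadjacent → Implies s (u, v) (v, w)
  | arc {u v : ℕ} : s (u, v) = .inArc → Implies s (u, v) (v, u)

section Entry

variable {V : Type} (P : PartiallyOrientedGraph V) (u v : V)

theorem entry_eq_outArc : P.entry u v = .outArc ↔ P.arcs.Adj u v := by
  unfold entry
  split_ifs <;> simp_all

theorem entry_eq_inArc : P.entry u v = .inArc ↔ P.arcs.Adj v u := by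
  have := P.arcs.asymm u v
  unfold entry
  split_ifs <;> simp_all

theorem entry_eq_edge : P.entry u v = .edge ↔ P.edges.Adj u v := by
  have h1 := P.disjoint u v
  have h2 := P.disjoint v u
  have h3 := P.edges.adj_comm u v
  unfold entry
  split_ifs <;> simp_all

theorem entry_ne_endRow : P.entry u v ≠ .endRow := by
  unfold entry
  split_ifs <;> simp

theorem isJoined_entry :
    (P.entry u v).isJoined ↔ P.arcs.Adj u v ∨ P.arcs.Adj v u ∨ P.edges.Adj u v := by
  rw [← entry_eq_outArc, ← entry_eq_inArc, ← entry_eq_edge]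
  cases P.entry u v <;> simp [Symbol.isJoined]

theorem isJoined_entry_comm : (P.entry u v).isJoined ↔ (P.entry v u).isJoined := by
  rw [isJoined_entry, isJoined_entry, P.edges.adj_comm]
  tauto

theorem entry_eq_nonadjacent : P.entry u v = .nonadjacent ↔ ¬ (P.entry u v).isJoined := by
  have := P.entry_ne_endRow u v
  cases h : P.entry u v <;> simp_all [Symbol.isJoined]

end Entry

/-- The adjacency matrix, with end markers outside the range of the vertices. -/
noncomputable def symbolAt (P : Instance) (p : ℕ × ℕ) : Symbol :=
  if h : p.1 < P.1 ∧ p.2 < P.1 then P.2.entry ⟨p.1, h.1⟩ ⟨p.2, h.2⟩ else .endRow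

theorem symbolAt_of_lt (P : Instance) {u v : ℕ} (hu : u < P.1) (hv : v < P.1) :
    symbolAt P (u, v) = P.2.entry ⟨u, hu⟩ ⟨v, hv⟩ := by
  simp [symbolAt, hu, hv]

theorem symbolAt_fin (P : Instance) (u v : Fin P.1) : symbolAt P (u, v) = P.2.entry u v :=
  symbolAt_of_lt P u.2 v.2

theorem lt_of_symbolAt_ne {P : Instance} {p : ℕ × ℕ} (h : symbolAt P p ≠ .endRow) :
    p.1 < P.1 ∧ p.2 < P.1 := by
  by_contra hp
  exact h (by simp only [symbolAt, hp, dif_neg, not_false_eq_true])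

theorem lt_of_isJoined {P : Instance} {p : ℕ × ℕ} (h : (symbolAt P p).isJoined) :
    p.1 < P.1 ∧ p.2 < P.1 :=
  lt_of_symbolAt_ne fun h' => by simp [h', Symbol.isJoined] at h

theorem isJoined_symbolAt_swap {P : Instance} {u v : ℕ} (h : (symbolAt P (u, v)).isJoined) :
    (symbolAt P (v, u)).isJoined := by
  obtain ⟨hu, hv⟩ := lt_of_isJoined h
  rw [symbolAt_of_lt P hu hv] at h
  rw [symbolAt_of_lt P hv hu]
  exact (P.2.isJoined_entry_comm _ _).1 h

theorem isJoined_of_implies_left {P : Instance} {p q : ℕ × ℕ} (h : Implies (symbolAt P) p q) :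
    (symbolAt P p).isJoined := by
  cases h with
  | path h => exact h
  | arc h => simp [h, Symbol.isJoined]

theorem isJoined_of_implies_right {P : Instance} {p q : ℕ × ℕ} (h : Implies (symbolAt P) p q) :
    (symbolAt P q).isJoined := by
  cases h with
  | path _ h => exact h
  | arc h => exact isJoined_symbolAt_swap (by simp [h, Symbol.isJoined])

/-- The path `u, v, w` read backwards gives the contrapositive; an implication coming from an arc is
its own contrapositive. -/
theorem implies_swap {P : Instance} {p q : ℕ × ℕ} (h : Implies (symbolAt P) p q) :
    Implies (symbolAt P) q.swap p.swap := by
  cases h with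
  | @path u v w h1 h2 h3 h4 =>
    refine .path (isJoined_symbolAt_swap h2) (isJoined_symbolAt_swap h1) h3.symm ?_
    obtain ⟨hu, hw⟩ := lt_of_symbolAt_ne (P := P) (p := (u, w)) (by simp [h4])
    rw [symbolAt_of_lt P hu hw, entry_eq_nonadjacent, isJoined_entry_comm] at h4
    rwa [symbolAt_of_lt P hw hu, entry_eq_nonadjacent]
  | arc h => exact .arc h

/-- No orientation of an edge or arc is equivalent to the opposite orientation. -/
def Consistent (P : Instance) : Prop :=
  ∀ p : ℕ × ℕ, (symbolAt P p).isJoined →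
    ¬ (Relation.ReflTransGen (Implies (symbolAt P)) p p.swap ∧
      Relation.ReflTransGen (Implies (symbolAt P)) p.swap p)

/-- The arcs of `D` form a set `T` closed under implication that contains exactly one orientation of
each joined pair. If an orientation were equivalent to its opposite, `T` would contain both. -/
theorem consistent_of_completion {P : Instance} {D : OrientedGraph (Fin P.1)}
    (hD : P.2.IsCompletion D) (hin : D.IsInTournament) : Consistent P := by
  have hor : ∀ u v : Fin P.1, (P.2.entry u v).isJoined ↔ D.Adj u v ∨ D.Adj v u := by
    intro u v
    rw [isJoined_entry]
    constructor
    · rintro (h | h | h)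
      · exact Or.inl (hD.keeps_arcs _ _ h)
      · exact Or.inr (hD.keeps_arcs _ _ h)
      · exact hD.orients_edges _ _ h
    · have hc := P.2.edges.adj_comm u v
      rintro (h | h) <;> rcases hD.adds_nothing _ _ h with h | h <;> simp_all
  let T (p : ℕ × ℕ) : Prop := ∃ u v : Fin P.1, p = (↑u, ↑v) ∧ D.Adj u v
  have hstep : ∀ p q, Implies (symbolAt P) p q → T p → T q := by
    rintro p q h ⟨u, v, rfl, huv⟩
    generalize hp : ((u : ℕ), (v : ℕ)) = p at h
    cases h with
    | @path u' v' w h1 h2 h3 h4 =>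
      obtain ⟨rfl, rfl⟩ := Prod.mk.inj hp
      obtain ⟨w, rfl⟩ : ∃ w' : Fin P.1, w = w' := ⟨⟨w, (lt_of_isJoined h2).2⟩, rfl⟩
      rw [symbolAt_fin] at h2 h4
      rw [entry_eq_nonadjacent, hor] at h4
      rcases (hor v w).1 h2 with h | h
      · exact ⟨v, w, rfl, h⟩
      · exact absurd (hin v ⟨u, huv⟩ ⟨w, h⟩ (by
          intro e
          exact h3 (congrArg (fun x => ((x : {u // D.Adj u v}).1 : ℕ)) e))) h4
    | @arc u' v' h =>
      obtain ⟨rfl, rfl⟩ := Prod.mk.inj hp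
      rw [symbolAt_fin, entry_eq_inArc] at h
      exact absurd (hD.keeps_arcs _ _ h) (D.asymm _ _ huv)
  have hreach : ∀ p q, Relation.ReflTransGen (Implies (symbolAt P)) p q → T p → T q := by
    intro p q h hp
    induction h with
    | refl => exact hp
    | tail _ h ih => exact hstep _ _ h ih
  have hasymm : ∀ p, T p → ¬ T p.swap := by
    rintro p ⟨u, v, rfl, h⟩ ⟨v', u', he, h'⟩
    obtain ⟨e1, e2⟩ := Prod.mk.inj he
    rw [← Fin.ext e1, ← Fin.ext e2] at h'
    exact D.asymm _ _ h h'
  rintro ⟨u, v⟩ hj ⟨h1, h2⟩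
  obtain ⟨hu, hv⟩ := lt_of_isJoined hj
  rw [symbolAt_of_lt P hu hv, hor] at hj
  rcases hj with h | h
  · have hT : T (u, v) := ⟨_, _, rfl, h⟩
    exact hasymm _ hT (hreach _ _ h1 hT)
  · have hT : T (v, u) := ⟨_, _, rfl, h⟩
    exact hasymm _ hT (hreach _ _ h2 hT)

/-- Orient every joined pair as a consistent assignment `S` says. Against a prescribed arc, `S`
would contain both orientations. If in-neighbours `u ≠ w` of `v` were not joined, `(u, v) ∈ S` would
force `(v, w) ∈ S`, contrary to `(w, v) ∈ S`. -/
theorem exists_completion_of_consistent {P : Instance} (hP : Consistent P) :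
    ∃ D : OrientedGraph (Fin P.1), P.2.IsCompletion D ∧ D.IsInTournament := by
  obtain ⟨S, hS, hSL⟩ := exists_truth_assignment (neg := Prod.swap)
    (R := Implies (symbolAt P)) (L := {p | (symbolAt P p).isJoined}) Prod.swap_swap
    (fun _ _ h => implies_swap h) (fun _ _ _ h => isJoined_of_implies_right h)
    (fun _ h => isJoined_symbolAt_swap h) hP
  have hS2 : ∀ u v : Fin P.1, (P.2.entry u v).isJoined → (((u : ℕ), (v : ℕ)) ∈ S ↔
      ((v : ℕ), (u : ℕ)) ∉ S) := fun u v h => hSL (u, v) (by rwa [Set.mem_ofPred, symbolAt_fin])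
  refine ⟨⟨⟨fun u v => (P.2.entry u v).isJoined ∧ ((u : ℕ), (v : ℕ)) ∈ S⟩, ?_⟩, ⟨?_, ?_, ?_⟩, ?_⟩
  · rintro u v ⟨h1, h2⟩ ⟨_, h4⟩
    exact (hS2 u v h1).1 h2 h4
  · intro u v h
    have hj : (P.2.entry u v).isJoined := (P.2.isJoined_entry u v).2 (Or.inl h)
    refine ⟨hj, ?_⟩
    rw [hS2 u v hj]
    intro hvu
    have hstep : Implies (symbolAt P) (↑v, ↑u) (↑u, ↑v) :=
      .arc (by rwa [symbolAt_fin, entry_eq_inArc])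
    exact (hS2 u v hj).1 (hS _ hvu _ hstep) hvu
  · intro u v h
    have hj : (P.2.entry u v).isJoined := (P.2.isJoined_entry u v).2 (Or.inr (Or.inr h))
    have hj' := (P.2.isJoined_entry_comm u v).1 hj
    by_cases huv : ((u : ℕ), (v : ℕ)) ∈ S
    · exact Or.inl ⟨hj, huv⟩
    · exact Or.inr ⟨hj', (hS2 v u hj').2 huv⟩
  · rintro u v ⟨h1, h2⟩
    rcases (P.2.isJoined_entry u v).1 h1 with h | h | h
    · exact Or.inl h
    · have hstep : Implies (symbolAt P) (↑u, ↑v) (↑v, ↑u) :=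
        .arc (by rwa [symbolAt_fin, entry_eq_inArc])
      exact absurd (hS _ h2 _ hstep) ((hS2 u v h1).1 h2)
    · exact Or.inr h
  · rintro v ⟨u, hu1, hu2⟩ ⟨w, hw1, hw2⟩ hne
    have hne' : (u : ℕ) ≠ w := fun e => hne (Subtype.ext (Fin.ext e))
    have hj : (P.2.entry u w).isJoined := by
      by_contra hj
      have hvw := (P.2.isJoined_entry_comm w v).1 hw1
      have hstep : Implies (symbolAt P) (↑u, ↑v) (↑v, ↑w) :=
        .path (by rwa [symbolAt_fin]) (by rwa [symbolAt_fin]) hne'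
          (by rwa [symbolAt_fin, entry_eq_nonadjacent])
      exact (hS2 v w hvw).1 (hS _ hu2 _ hstep) hw2
    by_cases huw : ((u : ℕ), (w : ℕ)) ∈ S
    · exact Or.inl ⟨hj, huw⟩
    · have hj' := (P.2.isJoined_entry_comm u w).1 hj
      exact Or.inr ⟨hj', (hS2 w u hj').2 huw⟩

theorem consistent_iff (P : Instance) :
    Consistent P ↔ OrientationCompletionProblem OrientedGraph.IsInTournament P :=
  ⟨exists_completion_of_consistent, fun ⟨_, h, h'⟩ => consistent_of_completion h h'⟩

end PartiallyOrientedGraph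

/-! ### Rules for reasoning about loops. -/

theorem iterateUpTo_rel {S : Type} {R : S → S → Prop} (hrefl : ∀ s, R s s)
    (htrans : ∀ {s t u}, R s t → R t u → R s u) {f : ℕ → S → S} {n : ℕ}
    (h : ∀ i < n, ∀ s, R s (f i s)) (s : S) : R s (iterateUpTo f s n) := by
  induction n with
  | zero => exact hrefl s
  | succ n ih => exact htrans (ih fun i hi => h i (by omega)) (h n (by omega) _)

/-- For effects of one particular round: `A` survives until round `i`, which turns it into `B`, and
`B` survives the remaining rounds. -/
theorem iterateUpTo_of_rel {S : Type} {R : S → S → Prop} (hrefl : ∀ s, R s s)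
    (htrans : ∀ {s t u}, R s t → R t u → R s u) {f : ℕ → S → S} {n : ℕ}
    (h : ∀ i < n, ∀ s, R s (f i s)) {A B : S → Prop} (hA : ∀ {s t}, R s t → A s → A t)
    (hB : ∀ {s t}, R s t → B s → B t) {i : ℕ} (hi : i < n) (hf : ∀ s, A s → B (f i s)) {s : S}
    (hs : A s) : B (iterateUpTo f s n) := by
  induction n with
  | zero => omega
  | succ n ih =>
    have hrel : R s (iterateUpTo f s n) := iterateUpTo_rel hrefl htrans (fun i hi => h i (by omega)) s
    rcases Nat.lt_succ_iff_lt_or_eq.1 hi with hi | rfl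
    · exact hB (h n (by omega) _) (ih (fun i hi => h i (by omega)) hi)
    · exact hf _ (hA hrel hs)

/-! ### The search program and the spreading of marks. -/

namespace InTournamentCompletion

open PartiallyOrientedGraph MatrixProg

/-- An entry of the matrix the program works on: the entry of the adjacency matrix, whether the
entry lies on the diagonal, whether the orientation it stands for has been reached from the current
one, and whether it implies the opposite orientation. -/
structure Cell where
  sym : Symbol
  diag : Bool
  mark : Bool
  conflict : Bool
  deriving DecidableEq, Fintype

instance : Inhabited Cell := ⟨⟨.endRow, false, false, false⟩⟩

/-- The memory of the program: two entries and whether an inconsistency has been found. -/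
structure Memory where
  fst : Cell
  snd : Cell
  failed : Bool
  deriving DecidableEq, Fintype

/-- The variables of the program. -/
inductive Var
  | a
  | b
  | i
  | j
  | u
  | v
  | w
  deriving DecidableEq

instance : Fintype Var where
  elems := {.a, .b, .i, .j, .u, .v, .w}
  complete x := by cases x <;> decide

/-- Programs on matrices of cells. -/
abbrev Prog : Type := MatrixProg Var Cell Memory

/-- States of such programs. -/
abbrev State : Type := Memory × (ℕ × ℕ → Cell)

/-- Read an entry into the first register. -/
def readFst (x y : Var) : Prog := .access x y fun r c => ({r with fst := c}, c)

/-- Read an entry into the second register. -/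
def readSnd (x y : Var) : Prog := .access x y fun r c => ({r with snd := c}, c)

/-- Mark the diagonal. -/
def markDiagonal : Prog := .loop .u (.access .u .u fun r c => (r, {c with diag := true}))

/-- Remove all marks. -/
def clearMarks : Prog := .loop .u (.loop .v (.access .u .v fun r c => (r, {c with mark := false})))

/-- Follow an implication from `(u, v)` to `(v, w)`. -/
def followPath : Prog :=
  .seq (readFst .u .v) (.seq (readSnd .u .w) (.access .v .w fun r c =>
    (r, {c with mark := c.mark || (r.fst.mark && r.fst.sym.isJoined && c.sym.isJoined &&
      !r.snd.diag && decide (r.snd.sym = .nonadjacent))})))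

/-- Follow an implication from `(u, v)` to `(v, u)`. -/
def followArc : Prog :=
  .seq (readFst .u .v) (.access .v .u fun r c =>
    (r, {c with mark := c.mark || (r.fst.mark && decide (r.fst.sym = .inArc))}))

/-- Follow all implications once. -/
def propagate : Prog := .loop .u (.loop .v (.seq (.loop .w followPath) followArc))

/-- Follow all implications as long as necessary. -/
def saturate : Prog := .loop .i (.loop .j propagate)

/-- Record whether `(a, b)` implies `(b, a)`. -/
def explore : Prog :=
  .seq clearMarks (.seq (.access .a .b fun r c => (r, {c with mark := true})) (.seq saturate
    (.seq (readFst .b .a) (.access .a .b fun r c => (r, {c with conflict := r.fst.mark})))))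

/-- Check whether `(a, b)` is equivalent to `(b, a)`. -/
def verdictAt : Prog :=
  .seq (readFst .a .b) (.access .b .a fun r c =>
    ({r with failed := r.failed || (r.fst.sym.isJoined && r.fst.conflict && c.conflict)}, c))

/-- Look for pairs that are equivalent to their opposites. -/
def verdict : Prog := .loop .a (.loop .b verdictAt)

/-- The program that decides the consistency of the implications. -/
def program : Prog := .seq markDiagonal (.seq (.loop .a (.loop .b explore)) verdict)

theorem wellFormed_program : program.WellFormed ∅ := by
  simp [program, markDiagonal, explore, clearMarks, saturate, propagate, followPath, followArc,
    verdict, verdictAt, readFst, readSnd, WellFormed]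

theorem eval_readFst (n : ℕ) (x y : Var) (e : Var → ℕ) (s : State) :
    MatrixProg.eval n (readFst x y) e s = ({s.1 with fst := s.2 (e x, e y)}, s.2) := by
  simp [readFst, MatrixProg.eval]

theorem eval_readSnd (n : ℕ) (x y : Var) (e : Var → ℕ) (s : State) :
    MatrixProg.eval n (readSnd x y) e s = ({s.1 with snd := s.2 (e x, e y)}, s.2) := by
  simp [readSnd, MatrixProg.eval]

/-- The state after marking the entry `p` if `b` holds. -/
def markIf (s : State) (m : Memory) (p : ℕ × ℕ) (b : Bool) : State :=
  (m, update s.2 p {s.2 p with mark := (s.2 p).mark || b})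

theorem eval_followPath (n : ℕ) (e : Var → ℕ) (s : State) :
    MatrixProg.eval n followPath e s =
      markIf s {s.1 with fst := s.2 (e .u, e .v), snd := s.2 (e .u, e .w)} (e .v, e .w)
        ((s.2 (e .u, e .v)).mark && (s.2 (e .u, e .v)).sym.isJoined &&
          (s.2 (e .v, e .w)).sym.isJoined && !(s.2 (e .u, e .w)).diag &&
          decide ((s.2 (e .u, e .w)).sym = .nonadjacent)) := by
  simp only [followPath, MatrixProg.eval, eval_readFst, eval_readSnd, markIf]

theorem eval_followArc (n : ℕ) (e : Var → ℕ) (s : State) :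
    MatrixProg.eval n followArc e s =
      markIf s {s.1 with fst := s.2 (e .u, e .v)} (e .v, e .u)
        ((s.2 (e .u, e .v)).mark && decide ((s.2 (e .u, e .v)).sym = .inArc)) := by
  simp only [followArc, MatrixProg.eval, eval_readFst, markIf]

variable {n : ℕ} {sym : ℕ × ℕ → Symbol}

/-- The fixed part of the matrix is as it should be. -/
def Valid (n : ℕ) (sym : ℕ × ℕ → Symbol) (s : State) : Prop :=
  (∀ p, (s.2 p).sym = sym p) ∧ ∀ p : ℕ × ℕ, p.1 < n → p.2 < n → ((s.2 p).diag ↔ p.1 = p.2)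

/-- Only marks differ. -/
structure SameButMarks (s t : State) : Prop where
  failed : t.1.failed = s.1.failed
  sym : ∀ p, (t.2 p).sym = (s.2 p).sym
  diag : ∀ p, (t.2 p).diag = (s.2 p).diag
  conflict : ∀ p, (t.2 p).conflict = (s.2 p).conflict

theorem SameButMarks.refl (s : State) : SameButMarks s s :=
  ⟨rfl, fun _ => rfl, fun _ => rfl, fun _ => rfl⟩

theorem SameButMarks.trans {s t u : State} (h : SameButMarks s t) (h' : SameButMarks t u) :
    SameButMarks s u :=
  ⟨h'.1.trans h.1, fun p => (h'.2 p).trans (h.2 p), fun p => (h'.3 p).trans (h.3 p),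
    fun p => (h'.4 p).trans (h.4 p)⟩

theorem sameButMarks_update_mark (s : State) (m : Memory) (hm : m.failed = s.1.failed) (p : ℕ × ℕ)
    (b : Bool) : SameButMarks s (m, update s.2 p {s.2 p with mark := b}) := by
  refine ⟨hm, fun q => ?_, fun q => ?_, fun q => ?_⟩ <;>
    by_cases h : q = p <;> simp [update, h]

theorem SameButMarks.valid {s t : State} (h : SameButMarks s t) (hs : Valid n sym s) :
    Valid n sym t :=
  ⟨fun p => (h.sym p).trans (hs.1 p), fun p h1 h2 => by rw [h.diag]; exact hs.2 p h1 h2⟩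

/-- Marks have been added following implications. -/
def Grows (n : ℕ) (sym : ℕ × ℕ → Symbol) (s t : State) : Prop :=
  SameButMarks s t ∧ (∀ p, (s.2 p).mark → (t.2 p).mark) ∧ (Valid n sym s → ∀ p, (t.2 p).mark →
    ∃ q, (s.2 q).mark ∧ Relation.ReflTransGen (Implies sym) q p)

theorem Grows.refl (s : State) : Grows n sym s s :=
  ⟨.refl s, fun _ h => h, fun _ p h => ⟨p, h, .refl⟩⟩

theorem Grows.trans {s t u : State} (h : Grows n sym s t) (h' : Grows n sym t u) :
    Grows n sym s u := by
  refine ⟨h.1.trans h'.1, fun p hp => h'.2.1 p (h.2.1 p hp), fun hs p hp => ?_⟩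
  obtain ⟨q, hq, hqp⟩ := h'.2.2 (h.1.valid hs) p hp
  obtain ⟨r, hr, hrq⟩ := h.2.2 hs q hq
  exact ⟨r, hr, hrq.trans hqp⟩

/-- Soundness of the search reduces to this: a new mark is allowed if a single implication leads to
it from a marked entry. -/
theorem grows_markIf {s : State} {m : Memory} (hm : m.failed = s.1.failed) {p : ℕ × ℕ} {b : Bool}
    (h : Valid n sym s → b = true → ∃ q, (s.2 q).mark ∧ Implies sym q p) :
    Grows n sym s (markIf s m p b) := by
  refine ⟨sameButMarks_update_mark s m hm p _, fun q hq => ?_, fun hs q hq => ?_⟩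
  · by_cases hqp : q = p
    · subst hqp; simp [markIf, hq]
    · simpa [markIf, hqp] using hq
  · by_cases hqp : q = p
    · subst hqp
      have hq' : (s.2 q).mark ∨ b = true := by simpa [markIf] using hq
      rcases hq' with hq' | hb
      · exact ⟨q, hq', .refl⟩
      · obtain ⟨r, hr, hrq⟩ := h hs hb
        exact ⟨r, hr, .single hrq⟩
    · exact ⟨q, by simpa [markIf, hqp] using hq, .refl⟩

theorem grows_followPath {e : Var → ℕ} (hu : e .u < n) (hw : e .w < n) (s : State) :
    Grows n sym s (MatrixProg.eval n followPath e s) := by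
  rw [eval_followPath]
  refine grows_markIf (by rfl) fun hs hb => ?_
  simp only [Bool.and_eq_true, Bool.not_eq_true', decide_eq_true_eq, hs.1] at hb
  obtain ⟨⟨⟨⟨h1, h2⟩, h3⟩, h4⟩, h5⟩ := hb
  refine ⟨_, h1, .path h2 h3 (fun h => ?_) h5⟩
  simp [(hs.2 (e .u, e .w) hu hw).2 h] at h4

theorem grows_followArc {e : Var → ℕ} (s : State) : Grows n sym s (MatrixProg.eval n followArc e s) := by
  rw [eval_followArc]
  refine grows_markIf (by rfl) fun hs hb => ?_
  simp only [Bool.and_eq_true, decide_eq_true_eq, hs.1] at hb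
  exact ⟨_, hb.1, .arc hb.2⟩

theorem grows_followPaths {e : Var → ℕ} (hu : e .u < n) (s : State) :
    Grows n sym s (MatrixProg.eval n (.loop .w followPath) e s) :=
  iterateUpTo_rel Grows.refl Grows.trans (fun i hi s => grows_followPath (by simpa) (by simpa) s) s

theorem grows_follow {e : Var → ℕ} (hu : e .u < n) (s : State) :
    Grows n sym s (MatrixProg.eval n (.seq (.loop .w followPath) followArc) e s) :=
  (grows_followPaths hu s).trans (grows_followArc _)

theorem grows_propagate_inner {e : Var → ℕ} (hu : e .u < n) (s : State) :
    Grows n sym s (MatrixProg.eval n (.loop .v (.seq (.loop .w followPath) followArc)) e s) :=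
  iterateUpTo_rel Grows.refl Grows.trans (fun i hi s => grows_follow (by simpa) s) s

theorem grows_propagate (e : Var → ℕ) (s : State) : Grows n sym s (MatrixProg.eval n propagate e s) :=
  iterateUpTo_rel Grows.refl Grows.trans (fun i hi s => grows_propagate_inner (by simpa) s) s

theorem Grows.valid_and_mark {s t : State} {p : ℕ × ℕ} (h : Grows n sym s t)
    (hs : Valid n sym s ∧ (s.2 p).mark) : Valid n sym t ∧ (t.2 p).mark :=
  ⟨h.1.valid hs.1, h.2.1 p hs.2⟩

/-- Completeness of the search for one implication. Marks only grow, so it is enough that the loop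
over `w` meets the right value once, or that the final `followArc` applies. -/
theorem mark_follow {u v : ℕ} (hu : u < n) {q : ℕ × ℕ} (hq : q.2 < n) (e : Var → ℕ) (s : State)
    (heu : e .u = u) (hev : e .v = v) (hpq : Implies sym (u, v) q)
    (hs : Valid n sym s ∧ (s.2 (u, v)).mark) :
    ((MatrixProg.eval n (.seq (.loop .w followPath) followArc) e s).2 q).mark := by
  have hu' : e .u < n := heu ▸ hu
  cases hpq with
  | @path _ _ w h1 h2 h3 h4 =>
    refine (grows_followArc (n := n) (sym := sym) _).2.1 _ ?_
    refine iterateUpTo_of_rel (R := Grows n sym) (A := fun s => Valid n sym s ∧ (s.2 (u, v)).mark)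
      (B := fun s => (s.2 (v, w)).mark) Grows.refl Grows.trans
      (fun i hi s => grows_followPath (by simpa) (by simpa) s) Grows.valid_and_mark
      (fun h => h.2.1 _) hq ?_ hs
    rintro s ⟨hs, hm⟩
    have hd : (s.2 (u, w)).diag = false := by
      rw [Bool.eq_false_iff]
      exact fun h => h3 ((hs.2 (u, w) hu hq).1 h)
    rw [eval_followPath]
    simp [markIf, heu, hev, hm, hs.1, h1, h2, h4, hd]
  | arc h =>
    obtain ⟨hs, hm⟩ := (grows_followPaths hu' s).valid_and_mark hs
    have h' : MatrixProg.eval n (.seq (.loop .w followPath) followArc) e s =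
      MatrixProg.eval n followArc e (MatrixProg.eval n (.loop .w followPath) e s) := rfl
    rw [h', eval_followArc]
    simp [markIf, heu, hev, hm, hs.1, h]

theorem mark_propagate (e : Var → ℕ) {p q : ℕ × ℕ} (hp : p.1 < n ∧ p.2 < n) (hq : q.2 < n)
    (hpq : Implies sym p q) {s : State} (hs : Valid n sym s) (hm : (s.2 p).mark) :
    ((MatrixProg.eval n propagate e s).2 q).mark := by
  obtain ⟨u, v⟩ := p
  refine iterateUpTo_of_rel (R := Grows n sym) (A := fun s => Valid n sym s ∧ (s.2 (u, v)).mark)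
    (B := fun s => (s.2 q).mark) Grows.refl Grows.trans
    (fun i hi s => grows_propagate_inner (by simpa) s) Grows.valid_and_mark
    (fun h => h.2.1 _) hp.1 ?_ ⟨hs, hm⟩
  intro s hs
  refine iterateUpTo_of_rel (R := Grows n sym) (A := fun s => Valid n sym s ∧ (s.2 (u, v)).mark)
    (B := fun s => (s.2 q).mark) Grows.refl Grows.trans
    (fun i hi s => grows_follow (by simpa using hp.1) s) Grows.valid_and_mark
    (fun h => h.2.1 _) hp.2 ?_ hs
  intro s hs
  exact mark_follow hp.1 hq _ s (by simp) (by simp) hpq hs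

/-- The set of marked entries is closed under implications. -/
def Closed (sym : ℕ × ℕ → Symbol) (s : State) : Prop :=
  ∀ p q, (s.2 p).mark → Implies sym p q → (s.2 q).mark

theorem Closed.mark_of_reflTransGen {s : State} (hc : Closed sym s) {p q : ℕ × ℕ}
    (h : Relation.ReflTransGen (Implies sym) p q) (hp : (s.2 p).mark) : (s.2 q).mark := by
  induction h with
  | refl => exact hp
  | tail _ h ih => exact hc _ _ ih h

/-- Every mark of `t` is reachable from a mark of `s`, hence was already in the closed set of `s`.
-/
theorem Closed.of_grows {s t : State} (hs : Valid n sym s) (h : Grows n sym s t)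
    (hc : Closed sym s) : Closed sym t := by
  intro p q hp hpq
  obtain ⟨r, hr, hrp⟩ := h.2.2 hs p hp
  exact h.2.1 q (hc p q (hc.mark_of_reflTransGen hrp hr) hpq)

/-- The number of marked entries. -/
def numMarks (n : ℕ) (s : State) : ℕ :=
  ((Finset.range n ×ˢ Finset.range n).filter fun p => (s.2 p).mark).card

end InTournamentCompletion

/-! ### Saturation: a quadratic number of rounds suffices. -/

namespace InTournamentCompletion

open PartiallyOrientedGraph MatrixProg

variable {n : ℕ} {sym : ℕ × ℕ → Symbol}

/-- Implications only concern entries of the matrix. -/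
def InRange (n : ℕ) (sym : ℕ × ℕ → Symbol) : Prop :=
  ∀ p q, Implies sym p q → (p.1 < n ∧ p.2 < n) ∧ q.1 < n ∧ q.2 < n

/-- If the marks are not closed, some implication leads from a marked entry to an unmarked one, and
one round marks the latter. -/
theorem numMarks_lt (hr : InRange n sym) (e : Var → ℕ) {s : State} (hs : Valid n sym s)
    (hc : ¬ Closed sym s) : numMarks n s < numMarks n (MatrixProg.eval n propagate e s) := by
  unfold Closed at hc
  push Not at hc
  obtain ⟨p, q, hp, hpq, hq⟩ := hc
  obtain ⟨hpr, hqr⟩ := hr p q hpq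
  refine Finset.card_lt_card (Finset.ssubset_iff_of_subset ?_ |>.2 ⟨q, ?_, ?_⟩)
  · exact Finset.monotone_filter_right _ fun p _ => (grows_propagate (sym := sym) e s).2.1 p
  · simp [hqr, mark_propagate e hpr hqr.2 hpq hs hp]
  · simp [hq]

/-- The set of marks is closed or has at least `k` elements. -/
def Progress (n : ℕ) (sym : ℕ × ℕ → Symbol) (k : ℕ) (s : State) : Prop :=
  Valid n sym s ∧ (Closed sym s ∨ k ≤ numMarks n s)

theorem progress_propagate (hr : InRange n sym) (e : Var → ℕ) {k : ℕ} {s : State}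
    (h : Progress n sym k s) : Progress n sym (k + 1) (MatrixProg.eval n propagate e s) := by
  have hg := grows_propagate (n := n) (sym := sym) e s
  refine ⟨hg.1.valid h.1, ?_⟩
  by_cases hc : Closed sym s
  · exact Or.inl (hc.of_grows h.1 hg)
  · exact Or.inr ((h.2.resolve_left hc).trans_lt (numMarks_lt hr e h.1 hc))

/-- The gain `d` per round is a parameter so that the lemma serves both nested loops of `saturate`,
with `d = 1` inside and `d = n * 1` outside. -/
theorem progress_iterateUpTo {f : ℕ → State → State} {d : ℕ}
    (hf : ∀ i k s, Progress n sym k s → Progress n sym (k + d) (f i s)) {k : ℕ} {s : State}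
    (h : Progress n sym k s) (m : ℕ) : Progress n sym (k + m * d) (iterateUpTo f s m) := by
  induction m with
  | zero => simpa [iterateUpTo] using h
  | succ m ih =>
    rw [Nat.succ_mul, ← add_assoc]
    exact hf m _ _ ih

theorem grows_saturate (e : Var → ℕ) (s : State) :
    Grows n sym s (MatrixProg.eval n saturate e s) :=
  iterateUpTo_rel Grows.refl Grows.trans (fun _ _ s =>
    iterateUpTo_rel Grows.refl Grows.trans (fun _ _ s => grows_propagate _ s) s) s

theorem closed_saturate (hr : InRange n sym) (e : Var → ℕ) {s : State} (hs : Valid n sym s) :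
    Closed sym (MatrixProg.eval n saturate e s) := by
  have h : Progress n sym (0 + n * (n * 1)) (MatrixProg.eval n saturate e s) :=
    progress_iterateUpTo (fun _ _ _ h =>
      progress_iterateUpTo (fun _ _ _ h => progress_propagate hr _ h) h n)
      ⟨hs, Or.inr (Nat.zero_le _)⟩ n
  rcases h.2 with h | h
  · exact h
  -- With `n * n` marks every entry in range is marked, and implications do not leave the range.
  · intro p q _ hpq
    have hall : (Finset.range n ×ˢ Finset.range n).filter
        (fun p => ((MatrixProg.eval n saturate e s).2 p).mark) =
        Finset.range n ×ˢ Finset.range n := by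
      refine Finset.eq_of_subset_of_card_le (Finset.filter_subset _ _) ?_
      simpa [numMarks] using h
    have hq : q ∈ Finset.range n ×ˢ Finset.range n := by simpa using (hr p q hpq).2
    rw [← hall] at hq
    exact (Finset.mem_filter.1 hq).2

/-! ### Clearing marks and recording which orientations force their opposites. -/

/-- Only marks have been removed. -/
def Clears (s t : State) : Prop :=
  SameButMarks s t ∧ ∀ p, (s.2 p).mark = false → (t.2 p).mark = false

theorem Clears.refl (s : State) : Clears s s :=
  ⟨.refl s, fun _ h => h⟩

theorem Clears.trans {s t u : State} (h : Clears s t) (h' : Clears t u) : Clears s u :=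
  ⟨h.1.trans h'.1, fun p hp => h'.2 p (h.2 p hp)⟩

theorem clears_update (s : State) (p : ℕ × ℕ) :
    Clears s (s.1, update s.2 p {s.2 p with mark := false}) := by
  refine ⟨sameButMarks_update_mark s s.1 rfl p false, fun q hq => ?_⟩
  by_cases h : q = p
  · subst h; simp
  · simpa [h] using hq

theorem clears_clearMarks_inner (e : Var → ℕ) (s : State) :
    Clears s (MatrixProg.eval n (.loop .v (.access .u .v fun r c => (r, {c with mark := false})))
      e s) :=
  iterateUpTo_rel Clears.refl Clears.trans (fun _ _ s => clears_update s _) s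

theorem clears_clearMarks (e : Var → ℕ) (s : State) :
    Clears s (MatrixProg.eval n clearMarks e s) :=
  iterateUpTo_rel Clears.refl Clears.trans (fun _ _ s => clears_clearMarks_inner _ s) s

theorem mark_clearMarks (e : Var → ℕ) (s : State) {p : ℕ × ℕ} (h1 : p.1 < n) (h2 : p.2 < n) :
    ((MatrixProg.eval n clearMarks e s).2 p).mark = false := by
  refine iterateUpTo_of_rel (R := Clears) (A := fun _ => True)
    (B := fun s => (s.2 p).mark = false) Clears.refl Clears.trans
    (fun _ _ s => clears_clearMarks_inner _ s) (fun _ _ => trivial) (fun h => h.2 p) h1 ?_ trivial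
  intro s _
  refine iterateUpTo_of_rel (R := Clears) (A := fun _ => True)
    (B := fun s => (s.2 p).mark = false) Clears.refl Clears.trans
    (fun _ _ s => clears_update s _) (fun _ _ => trivial) (fun h => h.2 p) h2 ?_ trivial
  intro s _
  simp

/-- The orientation `p` implies its opposite. -/
def Forces (sym : ℕ × ℕ → Symbol) (p : ℕ × ℕ) : Prop :=
  Relation.ReflTransGen (Implies sym) p p.swap

theorem eval_explore (hr : InRange n sym) (e : Var → ℕ) (ha : e .a < n) (hb : e .b < n) {s : State}
    (hs : Valid n sym s) :
    Valid n sym (MatrixProg.eval n explore e s) ∧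
      (MatrixProg.eval n explore e s).1.failed = s.1.failed ∧
      (∀ p ≠ (e .a, e .b), ((MatrixProg.eval n explore e s).2 p).conflict = (s.2 p).conflict) ∧
      (((MatrixProg.eval n explore e s).2 (e .a, e .b)).conflict ↔ Forces sym (e .a, e .b)) := by
  set p₀ : ℕ × ℕ := (e .a, e .b) with hp₀
  set s₁ := MatrixProg.eval n clearMarks e s with hs₁
  set s₂ : State := (s₁.1, update s₁.2 p₀ {s₁.2 p₀ with mark := true}) with hs₂
  set s₃ := MatrixProg.eval n saturate e s₂ with hs₃
  have heval : MatrixProg.eval n explore e s = ({s₃.1 with fst := s₃.2 (e .b, e .a)},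
      update s₃.2 p₀ {s₃.2 p₀ with conflict := (s₃.2 (e .b, e .a)).mark}) := by
    simp only [explore, MatrixProg.eval, eval_readFst, ← hs₁, ← hp₀, ← hs₂, ← hs₃]
  have h1 : SameButMarks s s₁ := (clears_clearMarks e s).1
  have h2 : SameButMarks s s₂ := h1.trans (sameButMarks_update_mark s₁ s₁.1 rfl p₀ true)
  have hg : Grows n sym s₂ s₃ := grows_saturate e s₂
  have h3 : SameButMarks s s₃ := h2.trans hg.1
  have hv2 : Valid n sym s₂ := h2.valid hs
  have hv3 : Valid n sym s₃ := h3.valid hs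
  have hc : Closed sym s₃ := closed_saturate hr e hv2
  have hm : (s₂.2 p₀).mark := by simp [hs₂]
  -- Entries outside the matrix are never cleared, so uniqueness of the mark holds only in range.
  have hm' : ∀ q : ℕ × ℕ, q.1 < n → q.2 < n → (s₂.2 q).mark → q = p₀ := by
    intro q hq1 hq2 hq
    by_contra h
    have := mark_clearMarks e s hq1 hq2
    simp [hs₂, h, hs₁, this] at hq
  rw [heval]
  refine ⟨⟨fun p => ?_, fun p hp1 hp2 => ?_⟩, h3.failed, fun p hp => ?_, ?_⟩
  · rw [← hv3.1 p]
    by_cases h : p = p₀ <;> simp [update, h]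
  · rw [← hv3.2 p hp1 hp2]
    by_cases h : p = p₀ <;> simp [update, h]
  · rw [← h3.conflict]
    simp [hp]
  · simp only [update_self]
    constructor
    · intro h
      obtain ⟨q, hq, hqp⟩ := hg.2.2 hv2 _ h
      -- The source `q` of the chain is in range: either the chain is trivial and `q` is the
      -- opposite of `p₀`, or `q` is the left side of an implication.
      have hqr : q.1 < n ∧ q.2 < n := by
        rcases Relation.ReflTransGen.cases_head hqp with h | ⟨r, h, _⟩
        · rw [h]; exact ⟨hb, ha⟩
        · exact (hr _ _ h).1
      rw [hm' q hqr.1 hqr.2 hq] at hqp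
      exact hqp
    · intro h
      exact hc.mark_of_reflTransGen h (hg.2.1 _ hm)

/-- Everything that has been recorded correctly remains so. -/
def Records (n : ℕ) (sym : ℕ × ℕ → Symbol) (s t : State) : Prop :=
  Valid n sym s → Valid n sym t ∧ t.1.failed = s.1.failed ∧
    ∀ p, ((s.2 p).conflict ↔ Forces sym p) → ((t.2 p).conflict ↔ Forces sym p)

theorem Records.refl (s : State) : Records n sym s s :=
  fun hs => ⟨hs, rfl, fun _ h => h⟩

theorem Records.trans {s t u : State} (h : Records n sym s t) (h' : Records n sym t u) :
    Records n sym s u := by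
  intro hs
  obtain ⟨h1, h2, h3⟩ := h hs
  obtain ⟨h1', h2', h3'⟩ := h' h1
  exact ⟨h1', h2'.trans h2, fun p hp => h3' p (h3 p hp)⟩

theorem records_explore (hr : InRange n sym) {e : Var → ℕ} (ha : e .a < n) (hb : e .b < n)
    (s : State) : Records n sym s (MatrixProg.eval n explore e s) := by
  intro hs
  obtain ⟨h1, h2, h3, h4⟩ := eval_explore hr e ha hb hs
  refine ⟨h1, h2, fun p hp => ?_⟩
  by_cases h : p = (e .a, e .b)
  · rw [h]; exact h4
  · rw [h3 p h]; exact hp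

theorem records_explore_inner (hr : InRange n sym) {e : Var → ℕ} (ha : e .a < n) (s : State) :
    Records n sym s (MatrixProg.eval n (.loop .b explore) e s) :=
  iterateUpTo_rel Records.refl Records.trans
    (fun _ _ s => records_explore hr (by simpa) (by simpa) s) s

theorem records_explore_all (hr : InRange n sym) (e : Var → ℕ) (s : State) :
    Records n sym s (MatrixProg.eval n (.loop .a (.loop .b explore)) e s) :=
  iterateUpTo_rel Records.refl Records.trans
    (fun _ _ s => records_explore_inner hr (by simpa) s) s

/-- The round belonging to `p` sets its flag correctly, and later rounds preserve correct flags.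
Validity is carried along in `B` because `Records` says nothing about invalid states. -/
theorem conflict_explore_all (hr : InRange n sym) (e : Var → ℕ) {s : State} (hs : Valid n sym s)
    {p : ℕ × ℕ} (h1 : p.1 < n) (h2 : p.2 < n) :
    ((MatrixProg.eval n (.loop .a (.loop .b explore)) e s).2 p).conflict ↔ Forces sym p := by
  refine (iterateUpTo_of_rel (R := Records n sym) (A := Valid n sym)
    (B := fun s => Valid n sym s ∧ ((s.2 p).conflict ↔ Forces sym p)) Records.refl Records.trans
    (fun _ _ s => records_explore_inner hr (by simpa) s) (fun h hs => (h hs).1)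
    (fun h hs => ⟨(h hs.1).1, (h hs.1).2.2 p hs.2⟩) h1 ?_ hs).2
  intro s hs
  refine iterateUpTo_of_rel (R := Records n sym) (A := Valid n sym)
    (B := fun s => Valid n sym s ∧ ((s.2 p).conflict ↔ Forces sym p)) Records.refl Records.trans
    (fun _ _ s => records_explore hr (by simpa) (by simpa) s) (fun h hs => (h hs).1)
    (fun h hs => ⟨(h hs.1).1, (h hs.1).2.2 p hs.2⟩) h2 ?_ hs
  intro s hs
  have := eval_explore hr (update (update e .a p.1) .b p.2) (by simpa) (by simpa) hs
  simp only [ne_eq, reduceCtorEq, not_false_eq_true, update_of_ne, update_self] at this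
  exact ⟨this.1, this.2.2.2⟩

/-! ### Marking the diagonal, the verdict, and correctness of the program. -/

/-- Only diagonal entries have been marked as such. -/
def MarksDiagonal (s t : State) : Prop :=
  t.1.failed = s.1.failed ∧ (∀ p, (t.2 p).sym = (s.2 p).sym) ∧
    (∀ p : ℕ × ℕ, p.1 ≠ p.2 → (t.2 p).diag = (s.2 p).diag) ∧ ∀ p, (s.2 p).diag → (t.2 p).diag

theorem MarksDiagonal.refl (s : State) : MarksDiagonal s s :=
  ⟨rfl, fun _ => rfl, fun _ _ => rfl, fun _ h => h⟩

theorem MarksDiagonal.trans {s t u : State} (h : MarksDiagonal s t) (h' : MarksDiagonal t u) :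
    MarksDiagonal s u :=
  ⟨h'.1.trans h.1, fun p => (h'.2.1 p).trans (h.2.1 p),
    fun p hp => (h'.2.2.1 p hp).trans (h.2.2.1 p hp), fun p hp => h'.2.2.2 p (h.2.2.2 p hp)⟩

theorem marksDiagonal_update (s : State) (u : ℕ) :
    MarksDiagonal s (s.1, update s.2 (u, u) {s.2 (u, u) with diag := true}) := by
  refine ⟨rfl, fun p => ?_, fun p hp => ?_, fun p hp => ?_⟩
  · by_cases h : p = (u, u) <;> simp [update, h]
  · have h : p ≠ (u, u) := by rintro rfl; exact hp rfl
    simp [h]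
  · by_cases h : p = (u, u)
    · simp [h]
    · simpa [h] using hp

theorem marksDiagonal_markDiagonal (e : Var → ℕ) (s : State) :
    MarksDiagonal s (MatrixProg.eval n markDiagonal e s) :=
  iterateUpTo_rel MarksDiagonal.refl MarksDiagonal.trans
    (fun _ _ s => marksDiagonal_update s _) s

theorem valid_markDiagonal (e : Var → ℕ) {s : State} (hsym : ∀ p, (s.2 p).sym = sym p)
    (hdiag : ∀ p, (s.2 p).diag = false) : Valid n sym (MatrixProg.eval n markDiagonal e s) := by
  obtain ⟨_, h2, h3, _⟩ := marksDiagonal_markDiagonal (n := n) e s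
  refine ⟨fun p => (h2 p).trans (hsym p), fun p hp _ => ⟨fun h => ?_, fun h => ?_⟩⟩
  · by_contra hne
    rw [h3 p hne, hdiag] at h
    exact Bool.false_ne_true h
  · refine iterateUpTo_of_rel (R := MarksDiagonal) (A := fun _ => True)
      (B := fun s => (s.2 p).diag) MarksDiagonal.refl MarksDiagonal.trans
      (fun _ _ s => marksDiagonal_update s _) (fun _ _ => trivial) (fun h => h.2.2.2 p) hp ?_
      trivial
    intro s _
    obtain ⟨u, v⟩ := p
    obtain rfl : u = v := h
    simp

/-- The recorded data exhibit an inconsistency at `p`. -/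
def Bad (M : ℕ × ℕ → Cell) (p : ℕ × ℕ) : Prop :=
  (M p).sym.isJoined ∧ (M p).conflict ∧ (M p.swap).conflict

/-- The memory has been updated according to the recorded data. -/
def Judges (n : ℕ) (s t : State) : Prop :=
  t.2 = s.2 ∧ (s.1.failed → t.1.failed) ∧
    (t.1.failed → s.1.failed ∨ ∃ p : ℕ × ℕ, p.1 < n ∧ p.2 < n ∧ Bad s.2 p)

theorem Judges.refl (s : State) : Judges n s s :=
  ⟨rfl, fun h => h, Or.inl⟩

theorem Judges.trans {s t u : State} (h : Judges n s t) (h' : Judges n t u) : Judges n s u := by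
  refine ⟨h'.1.trans h.1, fun hs => h'.2.1 (h.2.1 hs), fun hu => ?_⟩
  rcases h'.2.2 hu with ht | ht
  · exact h.2.2 ht
  · exact Or.inr (h.1 ▸ ht)

/-- The test `isJoined` cannot be dropped: a diagonal entry is its own opposite and satisfies
`Forces` trivially, but it is never joined. -/
theorem eval_verdictAt (e : Var → ℕ) (s : State) :
    (MatrixProg.eval n verdictAt e s).2 = s.2 ∧
      ((MatrixProg.eval n verdictAt e s).1.failed ↔ s.1.failed ∨ Bad s.2 (e .a, e .b)) := by
  simp [verdictAt, MatrixProg.eval, eval_readFst, Bad, and_assoc]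

theorem judges_verdictAt {e : Var → ℕ} (ha : e .a < n) (hb : e .b < n) (s : State) :
    Judges n s (MatrixProg.eval n verdictAt e s) := by
  obtain ⟨h1, h2⟩ := eval_verdictAt (n := n) e s
  exact ⟨h1, fun h => h2.2 (Or.inl h), fun h => (h2.1 h).imp_right fun h => ⟨_, ha, hb, h⟩⟩

theorem judges_verdict_inner {e : Var → ℕ} (ha : e .a < n) (s : State) :
    Judges n s (MatrixProg.eval n (.loop .b verdictAt) e s) :=
  iterateUpTo_rel Judges.refl Judges.trans (fun _ _ s => judges_verdictAt (by simpa) (by simpa) s) s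

theorem judges_verdict (e : Var → ℕ) (s : State) : Judges n s (MatrixProg.eval n verdict e s) :=
  iterateUpTo_rel Judges.refl Judges.trans (fun _ _ s => judges_verdict_inner (by simpa) s) s

theorem failed_verdict (e : Var → ℕ) (s : State) {p : ℕ × ℕ} (h1 : p.1 < n) (h2 : p.2 < n)
    (hp : Bad s.2 p) : (MatrixProg.eval n verdict e s).1.failed := by
  refine iterateUpTo_of_rel (R := Judges n) (A := fun s => Bad s.2 p)
    (B := fun s => s.1.failed) Judges.refl Judges.trans
    (fun _ _ s => judges_verdict_inner (by simpa) s) (fun h hs => h.1 ▸ hs) (fun h => h.2.1) h1 ?_ hp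
  intro s hs
  refine iterateUpTo_of_rel (R := Judges n) (A := fun s => Bad s.2 p)
    (B := fun s => s.1.failed) Judges.refl Judges.trans
    (fun _ _ s => judges_verdictAt (by simpa) (by simpa) s) (fun h hs => h.1 ▸ hs)
    (fun h => h.2.1) h2 ?_ hs
  intro s hs
  refine (eval_verdictAt (n := n) _ s).2.2 (Or.inr ?_)
  simpa using hs

/-- The matrix entry the program starts with. -/
def initialCell (x : Symbol) : Cell := ⟨x, false, false, false⟩

theorem failed_program (P : Instance) :
    (MatrixProg.eval P.1 program (fun _ => 0)
      (⟨default, default, false⟩, fun p => initialCell (symbolAt P p))).1.failed ↔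
      ¬ Consistent P := by
  have hr : InRange P.1 (symbolAt P) := fun p q h =>
    ⟨lt_of_isJoined (isJoined_of_implies_left h), lt_of_isJoined (isJoined_of_implies_right h)⟩
  set s₀ : State := (⟨default, default, false⟩, fun p => initialCell (symbolAt P p)) with hs₀
  set s₁ := MatrixProg.eval P.1 markDiagonal (fun _ => 0) s₀ with hs₁
  set s₂ := MatrixProg.eval P.1 (.loop .a (.loop .b explore)) (fun _ => 0) s₁ with hs₂
  have hv1 : Valid P.1 (symbolAt P) s₁ := valid_markDiagonal _ (fun _ => rfl) fun _ => rfl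
  obtain ⟨hv2, hf2, _⟩ := records_explore_all hr (fun _ => 0) s₁ hv1
  have hf : s₂.1.failed = false := hf2.trans (marksDiagonal_markDiagonal (fun _ => 0) s₀).1
  have hbad : ∀ p : ℕ × ℕ, p.1 < P.1 → p.2 < P.1 → (Bad s₂.2 p ↔
      (symbolAt P p).isJoined ∧ Forces (symbolAt P) p ∧ Forces (symbolAt P) p.swap) := by
    intro p h1 h2
    rw [Bad, hs₂, conflict_explore_all hr _ hv1 h1 h2,
      conflict_explore_all (p := p.swap) hr _ hv1 h2 h1, hv2.1]
  have heval : MatrixProg.eval P.1 program (fun _ => 0) s₀ =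
      MatrixProg.eval P.1 verdict (fun _ => 0) s₂ := rfl
  rw [heval]
  constructor
  · intro h hcons
    rcases (judges_verdict (fun _ => 0) s₂).2.2 h with h | ⟨p, h1, h2, h⟩
    · rw [hf] at h
      exact Bool.false_ne_true h
    · obtain ⟨hj, hp, hp'⟩ := (hbad p h1 h2).1 h
      exact hcons p hj ⟨hp, hp'⟩
  · intro h
    unfold Consistent at h
    push Not at h
    obtain ⟨p, hj, hp, hp'⟩ := h
    obtain ⟨h1, h2⟩ := lt_of_isJoined hj
    exact failed_verdict _ s₂ h1 h2 ((hbad p h1 h2).2 ⟨hj, hp, hp'⟩)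

/-! ### The input word as a matrix. -/

theorem flatMap_range_map {α : Type} (f : ℕ → ℕ → α) (n m : ℕ) :
    (List.range n).flatMap (fun u => (List.range m).map (f u)) =
      (List.range (n * m)).map fun p => f (p / m) (p % m) := by
  induction n with
  | zero => simp
  | succ n ih =>
    rw [List.range_succ, List.flatMap_append, ih, Nat.succ_mul, List.range_add, List.map_append]
    congr 1
    simp only [List.flatMap_cons, List.flatMap_nil, List.append_nil, List.map_map]
    refine List.map_congr_left fun v hv => ?_
    have hv' : v < m := List.mem_range.1 hv
    simp only [comp_apply]
    rw [mul_comm, Nat.mul_add_div (by omega), Nat.div_eq_of_lt hv', Nat.mul_add_mod,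
      Nat.mod_eq_of_lt hv', add_zero]

/-- Column `n` lies outside the range of the vertices, where `symbolAt` takes the value `endRow`; so
the markers at the row ends are the entries of the last of `n + 1` columns. -/
theorem encode_eq_flatten (P : Instance) : encode P = flatten P.1 (symbolAt P) := by
  rw [flatten, ← flatMap_range_map fun u v => symbolAt P (u, v)]
  rw [← List.map_coe_finRange_eq_range (n := P.1), List.flatMap_map, encode]
  refine List.flatMap_congr fun u _ => ?_
  rw [row, List.range_succ, List.map_append, ← List.map_coe_finRange_eq_range (n := P.1),
    List.map_map]
  congr 1
  · exact List.map_congr_left fun v _ => (symbolAt_fin P u v).symm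
  · simp [symbolAt]

theorem countP_encode (P : Instance) : (encode P).countP (fun x => decide (x = .endRow)) = P.1 := by
  have hrow : ∀ u, (P.2.row u).countP (fun x => decide (x = .endRow)) = 1 := by
    intro u
    rw [row, List.countP_append, List.countP_eq_zero.2]
    · simp
    · intro x hx
      obtain ⟨v, _, rfl⟩ := List.mem_map.1 hx
      simpa using P.2.entry_ne_endRow u v
  rw [encode, List.countP_flatMap]
  simp [comp_def, hrow]

end InTournamentCompletion

open InTournamentCompletion in
theorem theorem5p4 :
    IsPolynomialProblem PartiallyOrientedGraph.encode
      (OrientationCompletionProblem OrientedGraph.IsInTournament) := by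
  refine MatrixProg.isPolynomialProblem program wellFormed_program initialCell
    (fun c => decide (c.sym = .endRow)) ⟨default, default, false⟩ (fun m => !m.failed)
    PartiallyOrientedGraph.encode _ (fun P => P.1)
    (fun P p => initialCell (PartiallyOrientedGraph.symbolAt P p)) (fun P => ?_) (fun P => ?_)
    fun P => ?_
  · rw [encode_eq_flatten, MatrixProg.flatten, MatrixProg.flatten, List.map_map]
    rfl
  · rw [List.countP_map]
    exact countP_encode P
  · rw [Bool.not_eq_true', ← PartiallyOrientedGraph.consistent_iff, ← Bool.not_eq_true,
      failed_program, not_not]
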